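/- **Lemma.** Let $\mathcal E$ be an (elementary) topos, i.e. a category with finite limits that is cartesian closed and has a subobject classifier. For internal categories $\mathcal C,\mathcal D$ of $\mathcal E$ let $\mathcal C^{\mathcal D}$ be the internal category of internal functors $\mathcal D\to\mathcal C$ and internal natural transformations, and let $K:\mathcal C\to\mathcal C^{\mathcal D}$ be the internal functor that sends objects and morphisms to constant functors and constant transformations. Call $\mathcal C$ *complete* (relative to $\mathcal E$) if, for every internal category $\mathcal D$ of $\mathcal E$, the functor $K:\mathcal C\to\mathcal C^{\mathcal D}$ has an internal right adjoint $\mathcal C^{\mathcal D}\to\mathcal C$. Every complete internal category $\mathcal C$ of $\mathcal E$ is *algebraically complete*: every internal endofunctor $F:\mathcal C\to\mathcal C$ has an initial algebra. Here, for an object $T$ of $\mathcal E$, a $T$-indexed $F$-algebra is a pair $x:T\to\mathcal C_0$, $a:T\to\mathcal C_1$ with $\mathrm{dom}\,a=Fx$ and $\mathrm{cod}\,a=x$; a morphism $(x,a)\to(y,b)$ of $T$-indexed algebras is an $h:T\to\mathcal C_1$ with $\mathrm{dom}\,h=x$, $\mathrm{cod}\,h=y$ and $h\circ a=b\circ F h$.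 An *initial algebra* is a $1$-indexed algebra $A$ such that, for every $T$ and every $T$-indexed algebra $B$, there is exactly one morphism of $T$-indexed algebras from $A$, pulled back along $T\to 1$, to $B$. -/

import Mathlib

open CategoryTheory Limits MonoidalCategory CartesianMonoidalCategory

universe v u

/-! ### Internal categories, internal functors, internal natural transformations -/

/-- An internal category of `E`.  Composition is written in diagrammatic order: `comp` is defined
on the object of pairs `(f, g)` with `cod f = dom g` and sends such a pair to "`f` followed by
`g`".  Associativity is stated for generalized elements. -/
structure InternalCategory (E : Type u) [Category.{v} E] [HasPullbacks E] where
  obj : E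
  mor : E
  dom : mor ⟶ obj
  cod : mor ⟶ obj
  id : obj ⟶ mor
  comp : pullback cod dom ⟶ mor
  id_dom : id ≫ dom = 𝟙 obj
  id_cod : id ≫ cod = 𝟙 obj
  comp_dom : comp ≫ dom = pullback.fst cod dom ≫ dom
  comp_cod : comp ≫ cod = pullback.snd cod dom ≫ cod
  id_comp : pullback.lift (dom ≫ id) (𝟙 mor) (by simp [id_cod]) ≫ comp = 𝟙 mor
  comp_id : pullback.lift (𝟙 mor) (cod ≫ id) (by simp [id_dom]) ≫ comp = 𝟙 mor
  assoc : ∀ {T : E} (f g h : T ⟶ mor) (hfg : f ≫ cod = g ≫ dom) (hgh : g ≫ cod = h ≫ dom),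
    pullback.lift (pullback.lift f g hfg ≫ comp) h (by rw [Category.assoc, comp_cod, pullback.lift_snd_assoc, hgh]) ≫ comp =
      pullback.lift f (pullback.lift g h hgh ≫ comp) (by rw [Category.assoc, comp_dom, pullback.lift_fst_assoc, hfg]) ≫ comp

namespace InternalCategory

variable {E : Type u} [Category.{v} E] [HasPullbacks E] (C : InternalCategory E)

/-- The composite, in diagrammatic order, of two composable generalized morphisms of `C`. -/
noncomputable def compose {T : E} (f g : T ⟶ C.mor) (h : f ≫ C.cod = g ≫ C.dom) : T ⟶ C.mor :=
  pullback.lift f g h ≫ C.comp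

theorem compose_dom {T : E} (f g : T ⟶ C.mor) (h : f ≫ C.cod = g ≫ C.dom) :
    C.compose f g h ≫ C.dom = f ≫ C.dom := by
  rw [compose, Category.assoc, C.comp_dom, pullback.lift_fst_assoc]

theorem compose_cod {T : E} (f g : T ⟶ C.mor) (h : f ≫ C.cod = g ≫ C.dom) :
    C.compose f g h ≫ C.cod = g ≫ C.cod := by
  rw [compose, Category.assoc, C.comp_cod, pullback.lift_snd_assoc]

theorem comp_compose {S T : E} (t : S ⟶ T) (f g : T ⟶ C.mor) (h : f ≫ C.cod = g ≫ C.dom) :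
    t ≫ C.compose f g h = C.compose (t ≫ f) (t ≫ g) (by simp [h]) := by
  rw [compose, compose, ← Category.assoc]
  congr 1
  apply pullback.hom_ext
  · rw [Category.assoc, pullback.lift_fst, pullback.lift_fst]
  · rw [Category.assoc, pullback.lift_snd, pullback.lift_snd]

theorem compose_assoc {T : E} (f g k : T ⟶ C.mor) (hfg : f ≫ C.cod = g ≫ C.dom)
    (hgk : g ≫ C.cod = k ≫ C.dom) :
    C.compose (C.compose f g hfg) k (by rw [compose_cod, hgk]) =
      C.compose f (C.compose g k hgk) (by rw [compose_dom, hfg]) :=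
  C.assoc f g k hfg hgk

theorem id_compose {T : E} (x : T ⟶ C.obj) (f : T ⟶ C.mor) (hx : x = f ≫ C.dom) :
    C.compose (x ≫ C.id) f (by simp [C.id_cod, hx]) = f := by
  subst hx
  have h := C.comp_compose f (C.dom ≫ C.id) (𝟙 _) (by simp [C.id_cod])
  rw [compose, C.id_comp] at h
  simpa using h.symm

theorem compose_id {T : E} (x : T ⟶ C.obj) (f : T ⟶ C.mor) (hx : x = f ≫ C.cod) :
    C.compose f (x ≫ C.id) (by simp [C.id_dom, hx]) = f := by
  subst hx
  have h := C.comp_compose f (𝟙 _) (C.cod ≫ C.id) (by simp [C.id_dom])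
  rw [compose, C.comp_id] at h
  simpa using h.symm

theorem compose_congr {C : InternalCategory E} {T : E} {f f' g g' : T ⟶ C.mor} (hf : f = f')
    (hg : g = g') (h : f ≫ C.cod = g ≫ C.dom) :
    C.compose f g h = C.compose f' g' (by rw [← hf, ← hg, h]) := by
  subst hf hg; rfl

end InternalCategory

/-- An internal functor between internal categories. -/
structure InternalFunctor {E : Type u} [Category.{v} E] [HasPullbacks E]
    (C D : InternalCategory E) where
  obj : C.obj ⟶ D.obj
  mor : C.mor ⟶ D.mor
  mor_dom : mor ≫ D.dom = C.dom ≫ obj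
  mor_cod : mor ≫ D.cod = C.cod ≫ obj
  map_id : C.id ≫ mor = obj ≫ D.id
  map_comp : C.comp ≫ mor =
    D.compose (pullback.fst C.cod C.dom ≫ mor) (pullback.snd C.cod C.dom ≫ mor)
      (by simp only [Category.assoc, mor_cod, mor_dom, pullback.condition_assoc])

namespace InternalFunctor

variable {E : Type u} [Category.{v} E] [HasPullbacks E] {B C D : InternalCategory E}

/-- The identity internal functor. -/
noncomputable def identity (C : InternalCategory E) : InternalFunctor C C where
  obj := 𝟙 C.obj
  mor := 𝟙 C.mor
  mor_dom := by simp
  mor_cod := by simp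
  map_id := by simp
  map_comp := by
    have h := C.comp_compose (𝟙 _) (pullback.fst C.cod C.dom) (pullback.snd C.cod C.dom)
      pullback.condition
    have h' : pullback.lift (pullback.fst C.cod C.dom) (pullback.snd C.cod C.dom)
      pullback.condition = 𝟙 _ := by ext <;> simp
    simp [InternalCategory.compose, h']

theorem compose_mor (F : InternalFunctor C D) {T : E} (f g : T ⟶ C.mor)
    (h : f ≫ C.cod = g ≫ C.dom) :
    C.compose f g h ≫ F.mor = D.compose (f ≫ F.mor) (g ≫ F.mor)
      (by rw [Category.assoc, Category.assoc, F.mor_cod, F.mor_dom, reassoc_of% h]) := by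
  rw [InternalCategory.compose, Category.assoc, F.map_comp, D.comp_compose]
  refine congrArg (· ≫ D.comp) ?_
  apply pullback.hom_ext
  · rw [pullback.lift_fst, pullback.lift_fst, pullback.lift_fst_assoc]
  · rw [pullback.lift_snd, pullback.lift_snd, pullback.lift_snd_assoc]

/-- The composite "`F` followed by `G`" of internal functors. -/
noncomputable def comp (F : InternalFunctor B C) (G : InternalFunctor C D) :
    InternalFunctor B D where
  obj := F.obj ≫ G.obj
  mor := F.mor ≫ G.mor
  mor_dom := by rw [Category.assoc, G.mor_dom, reassoc_of% F.mor_dom]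
  mor_cod := by rw [Category.assoc, G.mor_cod, reassoc_of% F.mor_cod]
  map_id := by rw [reassoc_of% F.map_id, G.map_id, Category.assoc]
  map_comp := by
    rw [reassoc_of% F.map_comp, G.compose_mor]
    simp

end InternalFunctor

/-- An internal natural transformation between internal functors `C → D`. -/
structure InternalNatTrans {E : Type u} [Category.{v} E] [HasPullbacks E]
    {C D : InternalCategory E} (F G : InternalFunctor C D) where
  app : C.obj ⟶ D.mor
  app_dom : app ≫ D.dom = F.obj
  app_cod : app ≫ D.cod = G.obj
  naturality :
    D.compose F.mor (C.cod ≫ app) (by rw [F.mor_cod, Category.assoc, app_dom]) =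
      D.compose (C.dom ≫ app) G.mor (by rw [G.mor_dom, Category.assoc, app_cod])

/-- An internal adjunction `F ⊣ G`, given by unit, counit and the triangle identities. -/
structure InternalAdjunction {E : Type u} [Category.{v} E] [HasPullbacks E]
    {C D : InternalCategory E} (F : InternalFunctor C D) (G : InternalFunctor D C) where
  unit : InternalNatTrans (InternalFunctor.identity C) (F.comp G)
  counit : InternalNatTrans (G.comp F) (InternalFunctor.identity D)
  left_triangle :
    D.compose (unit.app ≫ F.mor) (F.obj ≫ counit.app)
      (by
        rw [Category.assoc, F.mor_cod, reassoc_of% unit.app_cod, Category.assoc, counit.app_dom]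
        simp [InternalFunctor.comp]) = F.obj ≫ D.id
  right_triangle :
    C.compose (G.obj ≫ unit.app) (counit.app ≫ G.mor)
      (by
        rw [Category.assoc, Category.assoc, G.mor_dom, reassoc_of% counit.app_dom, unit.app_cod]
        simp [InternalFunctor.comp]) = G.obj ≫ C.id

/-! ### The internal functor category

`T`-indexed families of functors `D → C` and of natural transformations between them, and the
objects of `E` that represent them. -/

namespace InternalCategory

section Families

variable {E : Type u} [Category.{v} E] [HasPullbacks E] [CartesianMonoidalCategory E]
  (D C : InternalCategory E)

/-- The pair `(a₀, a₁)` is a `T`-indexed family of internal functors `D → C`. -/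
structure IsFunctorFamily {T : E} (a₀ : D.obj ⊗ T ⟶ C.obj) (a₁ : D.mor ⊗ T ⟶ C.mor) : Prop where
  mor_dom : a₁ ≫ C.dom = D.dom ▷ T ≫ a₀
  mor_cod : a₁ ≫ C.cod = D.cod ▷ T ≫ a₀
  map_id : D.id ▷ T ≫ a₁ = a₀ ≫ C.id
  map_comp : D.comp ▷ T ≫ a₁ =
    C.compose (pullback.fst D.cod D.dom ▷ T ≫ a₁) (pullback.snd D.cod D.dom ▷ T ≫ a₁)
      (by
        rw [Category.assoc, Category.assoc, mor_cod, mor_dom, ← comp_whiskerRight_assoc,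
          ← comp_whiskerRight_assoc, pullback.condition])

/-- `α` is a `T`-indexed family of internal natural transformations between the `T`-indexed
families of functors `(a₀, a₁)` and `(b₀, b₁)`. -/
structure IsNatTransFamily {T : E} {a₀ : D.obj ⊗ T ⟶ C.obj} {a₁ : D.mor ⊗ T ⟶ C.mor}
    (ha : IsFunctorFamily D C a₀ a₁) {b₀ : D.obj ⊗ T ⟶ C.obj} {b₁ : D.mor ⊗ T ⟶ C.mor}
    (hb : IsFunctorFamily D C b₀ b₁) (α : D.obj ⊗ T ⟶ C.mor) : Prop where
  app_dom : α ≫ C.dom = a₀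
  app_cod : α ≫ C.cod = b₀
  naturality :
    C.compose a₁ (D.cod ▷ T ≫ α) (by rw [ha.mor_cod, Category.assoc, app_dom]) =
      C.compose (D.dom ▷ T ≫ α) b₁ (by rw [hb.mor_dom, Category.assoc, app_cod])

variable {D C}

theorem IsFunctorFamily.reindex {S T : E} (t : S ⟶ T) {a₀ : D.obj ⊗ T ⟶ C.obj}
    {a₁ : D.mor ⊗ T ⟶ C.mor} (h : IsFunctorFamily D C a₀ a₁) :
    IsFunctorFamily D C (D.obj ◁ t ≫ a₀) (D.mor ◁ t ≫ a₁) where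
  mor_dom := by rw [Category.assoc, h.mor_dom, whisker_exchange_assoc]
  mor_cod := by rw [Category.assoc, h.mor_cod, whisker_exchange_assoc]
  map_id := by rw [← whisker_exchange_assoc, h.map_id, Category.assoc]
  map_comp := by
    rw [← whisker_exchange_assoc, h.map_comp, comp_compose]
    exact compose_congr (whisker_exchange_assoc _ _ _) (whisker_exchange_assoc _ _ _) _

theorem isNatTransFamily_congr {T : E} {a₀ a₀' b₀ b₀' : D.obj ⊗ T ⟶ C.obj}
    {a₁ a₁' b₁ b₁' : D.mor ⊗ T ⟶ C.mor} {ha : IsFunctorFamily D C a₀ a₁}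
    {hb : IsFunctorFamily D C b₀ b₁} {α α' : D.obj ⊗ T ⟶ C.mor}
    (h : IsNatTransFamily D C ha hb α) (ea₀ : a₀ = a₀') (ea₁ : a₁ = a₁') (eb₀ : b₀ = b₀')
    (eb₁ : b₁ = b₁') (e : α = α') (ha' : IsFunctorFamily D C a₀' a₁')
    (hb' : IsFunctorFamily D C b₀' b₁') : IsNatTransFamily D C ha' hb' α' := by
  subst ea₀ ea₁ eb₀ eb₁ e; exact h

theorem IsNatTransFamily.reindex {S T : E} (t : S ⟶ T) {a₀ b₀ : D.obj ⊗ T ⟶ C.obj}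
    {a₁ b₁ : D.mor ⊗ T ⟶ C.mor} {ha : IsFunctorFamily D C a₀ a₁} {hb : IsFunctorFamily D C b₀ b₁}
    {α : D.obj ⊗ T ⟶ C.mor} (h : IsNatTransFamily D C ha hb α) :
    IsNatTransFamily D C (ha.reindex t) (hb.reindex t) (D.obj ◁ t ≫ α) where
  app_dom := by rw [Category.assoc, h.app_dom]
  app_cod := by rw [Category.assoc, h.app_cod]
  naturality := by
    have e := congrArg (fun x => D.mor ◁ t ≫ x) h.naturality
    simp only [comp_compose] at e
    rw [compose_congr rfl (whisker_exchange_assoc _ _ _).symm, e]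
    exact compose_congr (whisker_exchange_assoc _ _ _) rfl _

theorem IsNatTransFamily.identity {T : E} {a₀ : D.obj ⊗ T ⟶ C.obj} {a₁ : D.mor ⊗ T ⟶ C.mor}
    (ha : IsFunctorFamily D C a₀ a₁) : IsNatTransFamily D C ha ha (a₀ ≫ C.id) where
  app_dom := by rw [Category.assoc, C.id_dom, Category.comp_id]
  app_cod := by rw [Category.assoc, C.id_cod, Category.comp_id]
  naturality := by
    rw [compose_congr rfl (Category.assoc _ _ _).symm, C.compose_id _ _ ha.mor_cod.symm,
      compose_congr (Category.assoc _ _ _).symm rfl, C.id_compose _ _ ha.mor_dom.symm]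

theorem IsNatTransFamily.composite {T : E} {a₀ b₀ c₀ : D.obj ⊗ T ⟶ C.obj}
    {a₁ b₁ c₁ : D.mor ⊗ T ⟶ C.mor} {ha : IsFunctorFamily D C a₀ a₁}
    {hb : IsFunctorFamily D C b₀ b₁} {hc : IsFunctorFamily D C c₀ c₁}
    {α β : D.obj ⊗ T ⟶ C.mor} (hα : IsNatTransFamily D C ha hb α)
    (hβ : IsNatTransFamily D C hb hc β) :
    IsNatTransFamily D C ha hc (C.compose α β (hα.app_cod.trans hβ.app_dom.symm)) where
  app_dom := by rw [compose_dom, hα.app_dom]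
  app_cod := by rw [compose_cod, hβ.app_cod]
  naturality := by
    rw [compose_congr rfl (C.comp_compose _ _ _ _), compose_congr (C.comp_compose _ _ _ _) rfl,
      ← C.compose_assoc, compose_congr hα.naturality rfl, C.compose_assoc,
      compose_congr rfl hβ.naturality, C.compose_assoc]
    all_goals
      simp only [Category.assoc, ha.mor_cod, hb.mor_cod, hα.app_dom, hβ.app_dom]

/-- The constant family of functors at a `T`-indexed family of objects. -/
theorem IsFunctorFamily.const {T : E} (x : T ⟶ C.obj) :
    IsFunctorFamily D C (snd D.obj T ≫ x) (snd D.mor T ≫ x ≫ C.id) where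
  mor_dom := by simp [C.id_dom]
  mor_cod := by simp [C.id_cod]
  map_id := by simp
  map_comp := by
    have h : ∀ {S : E} (y : S ⟶ C.obj), C.compose (y ≫ C.id) (y ≫ C.id)
        (by simp [C.id_dom, C.id_cod]) = y ≫ C.id := fun y =>
      C.id_compose y (y ≫ C.id) (by simp [C.id_dom])
    have h' := h (snd (pullback D.cod D.dom) T ≫ x)
    rw [whiskerRight_snd_assoc, ← Category.assoc, ← h']
    exact compose_congr (by simp) (by simp) _

/-- The constant family of natural transformations at a `T`-indexed family of morphisms. -/
theorem IsNatTransFamily.const {T : E} (f : T ⟶ C.mor) :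
    IsNatTransFamily D C (IsFunctorFamily.const (f ≫ C.dom)) (IsFunctorFamily.const (f ≫ C.cod))
      (snd D.obj T ≫ f) where
  app_dom := by simp
  app_cod := by simp
  naturality := by
    have h₁ := C.id_compose (snd D.mor T ≫ f ≫ C.dom) (snd D.mor T ≫ f) (by simp)
    have h₂ := C.compose_id (snd D.mor T ≫ f ≫ C.cod) (snd D.mor T ≫ f) (by simp)
    exact ((compose_congr (by simp) (by simp) _).trans h₁).trans
      (h₂.symm.trans (compose_congr (by simp) (by simp) _))

end Families

section FunctorCategory

variable {E : Type u} [Category.{v} E] [CartesianMonoidalCategory E] [HasFiniteLimits E]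
  [MonoidalClosed E]

open MonoidalClosed

/-- For `u w : X ⊗ T ⟶ Y`, the subobject `{t : T | ∀ x : X, u (x, t) = w (x, t)}` of `T`. -/
noncomputable def eqLocus {X T Y : E} (u w : X ⊗ T ⟶ Y) : E :=
  equalizer (curry u) (curry w)

/-- The inclusion of `eqLocus u w` in `T`. -/
noncomputable def eqLocusι {X T Y : E} (u w : X ⊗ T ⟶ Y) : eqLocus u w ⟶ T :=
  equalizer.ι (curry u) (curry w)

instance {X T Y : E} (u w : X ⊗ T ⟶ Y) : Mono (eqLocusι u w) := by
  exact equalizer.ι_mono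

theorem eqLocus_condition {X T Y : E} (u w : X ⊗ T ⟶ Y) :
    X ◁ eqLocusι u w ≫ u = X ◁ eqLocusι u w ≫ w := by
  apply curry_injective
  rw [curry_natural_left, curry_natural_left]
  exact equalizer.condition _ _

/-- The universal property of `eqLocus`. -/
theorem eqLocus_factor {X S T Y : E} (u w : X ⊗ T ⟶ Y) (t : S ⟶ T)
    (h : X ◁ t ≫ u = X ◁ t ≫ w) : ∃ s : S ⟶ eqLocus u w, s ≫ eqLocusι u w = t :=
  ⟨equalizer.lift t (by rw [← curry_natural_left, ← curry_natural_left, h]),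
    equalizer.lift_ι _ _⟩

variable (D C : InternalCategory E)

/-! #### The object of functors -/

/-- The object of pairs consisting of a map on objects and a map on morphisms. -/
noncomputable abbrev preFun₀ : E := (ihom D.obj).obj C.obj ⊗ (ihom D.mor).obj C.mor

/-- The first component of the universal family over a subobject of `preFun₀ D C`. -/
noncomputable abbrev univ₀ {T : E} (i : T ⟶ preFun₀ D C) : D.obj ⊗ T ⟶ C.obj :=
  uncurry (i ≫ fst _ _)

/-- The second component of the universal family over a subobject of `preFun₀ D C`. -/
noncomputable abbrev univ₁ {T : E} (i : T ⟶ preFun₀ D C) : D.mor ⊗ T ⟶ C.mor :=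
  uncurry (i ≫ snd _ _)

variable {D C} in
theorem univ₀_reindex {S T : E} (t : S ⟶ T) (i : T ⟶ preFun₀ D C) :
    D.obj ◁ t ≫ univ₀ D C i = univ₀ D C (t ≫ i) := by
  rw [univ₀, univ₀, Category.assoc, ← uncurry_natural_left]

variable {D C} in
theorem univ₁_reindex {S T : E} (t : S ⟶ T) (i : T ⟶ preFun₀ D C) :
    D.mor ◁ t ≫ univ₁ D C i = univ₁ D C (t ≫ i) := by
  rw [univ₁, univ₁, Category.assoc, ← uncurry_natural_left]

/-- The subobject of `preFun₀` of pairs that are compatible with `dom`. -/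
noncomputable def preFun₁ : E :=
  eqLocus (univ₁ D C (𝟙 _) ≫ C.dom) (D.dom ▷ _ ≫ univ₀ D C (𝟙 _))

/-- The inclusion of `preFun₁`. -/
noncomputable def preFun₁ι : preFun₁ D C ⟶ preFun₀ D C := eqLocusι _ _

/-- The subobject of `preFun₁` of pairs that are compatible with `cod`. -/
noncomputable def preFun₂ : E :=
  eqLocus (univ₁ D C (preFun₁ι D C) ≫ C.cod) (D.cod ▷ _ ≫ univ₀ D C (preFun₁ι D C))

/-- The inclusion of `preFun₂` in `preFun₁`. -/
noncomputable def preFun₂j : preFun₂ D C ⟶ preFun₁ D C := eqLocusι _ _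

/-- The inclusion of `preFun₂` in `preFun₀`. -/
noncomputable def preFun₂ι : preFun₂ D C ⟶ preFun₀ D C := preFun₂j D C ≫ preFun₁ι D C

/-- The subobject of `preFun₂` of pairs that preserve identities. -/
noncomputable def preFun₃ : E :=
  eqLocus (D.id ▷ _ ≫ univ₁ D C (preFun₂ι D C)) (univ₀ D C (preFun₂ι D C) ≫ C.id)

/-- The inclusion of `preFun₃` in `preFun₂`. -/
noncomputable def preFun₃j : preFun₃ D C ⟶ preFun₂ D C := eqLocusι _ _

/-- The inclusion of `preFun₃` in `preFun₀`. -/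
noncomputable def preFun₃ι : preFun₃ D C ⟶ preFun₀ D C := preFun₃j D C ≫ preFun₂ι D C

theorem preFun₁_dom :
    univ₁ D C (preFun₁ι D C) ≫ C.dom = D.dom ▷ _ ≫ univ₀ D C (preFun₁ι D C) := by
  have h := eqLocus_condition (univ₁ D C (𝟙 _) ≫ C.dom) (D.dom ▷ _ ≫ univ₀ D C (𝟙 _))
  rw [← Category.assoc, univ₁_reindex, whisker_exchange_assoc, univ₀_reindex,
    Category.comp_id] at h
  exact h

theorem preFun₂_cod :
    univ₁ D C (preFun₂ι D C) ≫ C.cod = D.cod ▷ _ ≫ univ₀ D C (preFun₂ι D C) := by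
  have h := eqLocus_condition (univ₁ D C (preFun₁ι D C) ≫ C.cod)
    (D.cod ▷ _ ≫ univ₀ D C (preFun₁ι D C))
  rw [← Category.assoc, univ₁_reindex, whisker_exchange_assoc, univ₀_reindex] at h
  exact h

theorem preFun₃_id :
    D.id ▷ _ ≫ univ₁ D C (preFun₃ι D C) = univ₀ D C (preFun₃ι D C) ≫ C.id := by
  have h := eqLocus_condition (D.id ▷ _ ≫ univ₁ D C (preFun₂ι D C))
    (univ₀ D C (preFun₂ι D C) ≫ C.id)
  rw [whisker_exchange_assoc, univ₁_reindex, ← Category.assoc, univ₀_reindex] at h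
  exact h

theorem preFun₃_dom :
    univ₁ D C (preFun₃ι D C) ≫ C.dom = D.dom ▷ _ ≫ univ₀ D C (preFun₃ι D C) := by
  rw [preFun₃ι, preFun₂ι, ← univ₁_reindex, ← univ₁_reindex, ← univ₀_reindex, ← univ₀_reindex,
    Category.assoc, Category.assoc, preFun₁_dom, whisker_exchange_assoc, whisker_exchange_assoc]

theorem preFun₃_cod :
    univ₁ D C (preFun₃ι D C) ≫ C.cod = D.cod ▷ _ ≫ univ₀ D C (preFun₃ι D C) := by
  rw [preFun₃ι, ← univ₁_reindex, ← univ₀_reindex, Category.assoc, preFun₂_cod,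
    whisker_exchange_assoc]

/-- On `preFun₃`: the image of the composite. -/
noncomputable abbrev funCompL :
    pullback D.cod D.dom ⊗ preFun₃ D C ⟶ C.mor :=
  D.comp ▷ _ ≫ univ₁ D C (preFun₃ι D C)

/-- On `preFun₃`: the composite of the images. -/
noncomputable abbrev funCompR :
    pullback D.cod D.dom ⊗ preFun₃ D C ⟶ C.mor :=
  C.compose (pullback.fst D.cod D.dom ▷ _ ≫ univ₁ D C (preFun₃ι D C))
    (pullback.snd D.cod D.dom ▷ _ ≫ univ₁ D C (preFun₃ι D C))
    (by
      rw [Category.assoc, Category.assoc, preFun₃_cod, preFun₃_dom, ← comp_whiskerRight_assoc,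
        ← comp_whiskerRight_assoc, pullback.condition])

/-- The object of internal functors `D → C`: the subobject of `preFun₃` of pairs that preserve
composition. -/
noncomputable def funObj : E := eqLocus (funCompL D C) (funCompR D C)

/-- The inclusion of the object of functors in `preFun₃`. -/
noncomputable def funObjj : funObj D C ⟶ preFun₃ D C := eqLocusι _ _

/-- The inclusion of the object of functors in the object of pairs. -/
noncomputable def funObjι : funObj D C ⟶ preFun₀ D C := funObjj D C ≫ preFun₃ι D C

instance : Mono (preFun₁ι D C) := inferInstanceAs (Mono (eqLocusι _ _))

instance : Mono (preFun₂j D C) := inferInstanceAs (Mono (eqLocusι _ _))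

instance : Mono (preFun₃j D C) := inferInstanceAs (Mono (eqLocusι _ _))

instance : Mono (funObjj D C) := inferInstanceAs (Mono (eqLocusι _ _))

instance : Mono (funObjι D C) := by
  unfold funObjι preFun₃ι preFun₂ι; infer_instance

variable {D C}

/-- The universal family of functors, object part, pulled back along `F : T ⟶ funObj D C`. -/
noncomputable def famObj {T : E} (F : T ⟶ funObj D C) : D.obj ⊗ T ⟶ C.obj :=
  univ₀ D C (F ≫ funObjι D C)

/-- The universal family of functors, morphism part, pulled back along `F : T ⟶ funObj D C`. -/
noncomputable def famMor {T : E} (F : T ⟶ funObj D C) : D.mor ⊗ T ⟶ C.mor :=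
  univ₁ D C (F ≫ funObjι D C)

theorem famObj_reindex {S T : E} (t : S ⟶ T) (F : T ⟶ funObj D C) :
    famObj (t ≫ F) = D.obj ◁ t ≫ famObj F := by
  rw [famObj, famObj, univ₀_reindex, Category.assoc]

theorem famMor_reindex {S T : E} (t : S ⟶ T) (F : T ⟶ funObj D C) :
    famMor (t ≫ F) = D.mor ◁ t ≫ famMor F := by
  rw [famMor, famMor, univ₁_reindex, Category.assoc]

theorem isFunctorFamily_univ :
    IsFunctorFamily D C (univ₀ D C (funObjι D C)) (univ₁ D C (funObjι D C)) where
  mor_dom := by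
    rw [funObjι, ← univ₁_reindex, ← univ₀_reindex, Category.assoc, preFun₃_dom,
      whisker_exchange_assoc]
  mor_cod := by
    rw [funObjι, ← univ₁_reindex, ← univ₀_reindex, Category.assoc, preFun₃_cod,
      whisker_exchange_assoc]
  map_id := by
    rw [funObjι, ← univ₁_reindex, ← univ₀_reindex, Category.assoc, ← preFun₃_id,
      whisker_exchange_assoc]
  map_comp := by
    have h := eqLocus_condition (funCompL D C) (funCompR D C)
    rw [funCompL, funCompR, whisker_exchange_assoc, univ₁_reindex, comp_compose] at h
    refine h.trans (compose_congr ?_ ?_ _)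
    · rw [whisker_exchange_assoc, univ₁_reindex, funObjι]; rfl
    · rw [whisker_exchange_assoc, univ₁_reindex, funObjι]; rfl

theorem isFunctorFamily_fam {T : E} (F : T ⟶ funObj D C) :
    IsFunctorFamily D C (famObj F) (famMor F) := by
  have h := (isFunctorFamily_univ (D := D) (C := C)).reindex F
  rwa [univ₀_reindex, univ₁_reindex] at h

/-- Every `T`-indexed family of functors is classified by a map to `funObj`. -/
theorem exists_funLift {T : E} {a₀ : D.obj ⊗ T ⟶ C.obj} {a₁ : D.mor ⊗ T ⟶ C.mor}
    (h : IsFunctorFamily D C a₀ a₁) :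
    ∃ F : T ⟶ funObj D C, F ≫ funObjι D C = lift (curry a₀) (curry a₁) := by
  have e₀ : univ₀ D C (lift (curry a₀) (curry a₁)) = a₀ := by simp [univ₀]
  have e₁ : univ₁ D C (lift (curry a₀) (curry a₁)) = a₁ := by simp [univ₁]
  generalize lift (curry a₀) (curry a₁) = i at e₀ e₁
  subst e₀ e₁
  obtain ⟨t₁, ht₁⟩ : ∃ t, t ≫ preFun₁ι D C = i := by
    apply eqLocus_factor
    rw [← Category.assoc, univ₁_reindex, whisker_exchange_assoc, univ₀_reindex, Category.comp_id]
    exact h.mor_dom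
  obtain ⟨t₂, ht₂⟩ : ∃ t, t ≫ preFun₂j D C = t₁ := by
    apply eqLocus_factor
    rw [← Category.assoc, univ₁_reindex, whisker_exchange_assoc, univ₀_reindex, ht₁]
    exact h.mor_cod
  have hi₂ : t₂ ≫ preFun₂ι D C = i := by rw [preFun₂ι, ← Category.assoc, ht₂, ht₁]
  obtain ⟨t₃, ht₃⟩ : ∃ t, t ≫ preFun₃j D C = t₂ := by
    apply eqLocus_factor
    rw [whisker_exchange_assoc, univ₁_reindex, ← Category.assoc, univ₀_reindex, hi₂]
    exact h.map_id
  have hi₃ : t₃ ≫ preFun₃ι D C = i := by rw [preFun₃ι, ← Category.assoc, ht₃, hi₂]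
  obtain ⟨t₄, ht₄⟩ : ∃ t, t ≫ funObjj D C = t₃ := by
    apply eqLocus_factor
    rw [funCompL, funCompR, whisker_exchange_assoc, univ₁_reindex, comp_compose, hi₃, h.map_comp]
    refine compose_congr ?_ ?_ _
    · rw [whisker_exchange_assoc, univ₁_reindex, hi₃]
    · rw [whisker_exchange_assoc, univ₁_reindex, hi₃]
  exact ⟨t₄, by rw [funObjι, ← Category.assoc, ht₄, hi₃]⟩

/-- The map to `funObj` that classifies a `T`-indexed family of functors. -/
noncomputable def funLift {T : E} {a₀ : D.obj ⊗ T ⟶ C.obj} {a₁ : D.mor ⊗ T ⟶ C.mor}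
    (h : IsFunctorFamily D C a₀ a₁) : T ⟶ funObj D C :=
  (exists_funLift h).choose

theorem famObj_funLift {T : E} {a₀ : D.obj ⊗ T ⟶ C.obj} {a₁ : D.mor ⊗ T ⟶ C.mor}
    (h : IsFunctorFamily D C a₀ a₁) : famObj (funLift h) = a₀ := by
  rw [famObj, univ₀, funLift, (exists_funLift h).choose_spec, lift_fst, uncurry_curry]

theorem famMor_funLift {T : E} {a₀ : D.obj ⊗ T ⟶ C.obj} {a₁ : D.mor ⊗ T ⟶ C.mor}
    (h : IsFunctorFamily D C a₀ a₁) : famMor (funLift h) = a₁ := by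
  rw [famMor, univ₁, funLift, (exists_funLift h).choose_spec, lift_snd, uncurry_curry]

theorem funObj_hom_ext {T : E} {F G : T ⟶ funObj D C} (h₀ : famObj F = famObj G)
    (h₁ : famMor F = famMor G) : F = G := by
  rw [← cancel_mono (funObjι D C)]
  exact CartesianMonoidalCategory.hom_ext _ _ (uncurry_injective h₀) (uncurry_injective h₁)

/-! #### The object of natural transformations -/

variable (D C)

/-- The object of triples: two functors and a map from objects of `D` to morphisms of `C`. -/
noncomputable abbrev preNat₀ : E := (funObj D C ⊗ funObj D C) ⊗ (ihom D.obj).obj C.mor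

variable {D C}

/-- The first functor of a generalized triple. -/
noncomputable abbrev natSrc {T : E} (i : T ⟶ preNat₀ D C) : T ⟶ funObj D C :=
  i ≫ fst _ _ ≫ fst _ _

/-- The second functor of a generalized triple. -/
noncomputable abbrev natTgt {T : E} (i : T ⟶ preNat₀ D C) : T ⟶ funObj D C :=
  i ≫ fst _ _ ≫ snd _ _

/-- The map from objects of `D` to morphisms of `C` of a generalized triple. -/
noncomputable abbrev natApp {T : E} (i : T ⟶ preNat₀ D C) : D.obj ⊗ T ⟶ C.mor :=
  uncurry (i ≫ snd _ _)

theorem natSrc_reindex {S T : E} (t : S ⟶ T) (i : T ⟶ preNat₀ D C) :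
    t ≫ natSrc i = natSrc (t ≫ i) := (Category.assoc _ _ _).symm

theorem natTgt_reindex {S T : E} (t : S ⟶ T) (i : T ⟶ preNat₀ D C) :
    t ≫ natTgt i = natTgt (t ≫ i) := (Category.assoc _ _ _).symm

theorem natApp_reindex {S T : E} (t : S ⟶ T) (i : T ⟶ preNat₀ D C) :
    D.obj ◁ t ≫ natApp i = natApp (t ≫ i) := by
  rw [natApp, natApp, Category.assoc, ← uncurry_natural_left]

variable (D C)

/-- The subobject of `preNat₀` of triples whose third entry has the correct domains. -/
noncomputable def preNat₁ : E :=
  eqLocus (natApp (𝟙 (preNat₀ D C)) ≫ C.dom) (famObj (natSrc (𝟙 (preNat₀ D C))))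

/-- The inclusion of `preNat₁`. -/
noncomputable def preNat₁ι : preNat₁ D C ⟶ preNat₀ D C := eqLocusι _ _

/-- The subobject of `preNat₁` of triples whose third entry has the correct codomains. -/
noncomputable def preNat₂ : E :=
  eqLocus (natApp (preNat₁ι D C) ≫ C.cod) (famObj (natTgt (preNat₁ι D C)))

/-- The inclusion of `preNat₂` in `preNat₁`. -/
noncomputable def preNat₂j : preNat₂ D C ⟶ preNat₁ D C := eqLocusι _ _

/-- The inclusion of `preNat₂` in `preNat₀`. -/
noncomputable def preNat₂ι : preNat₂ D C ⟶ preNat₀ D C := preNat₂j D C ≫ preNat₁ι D C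

theorem preNat₁_dom : natApp (preNat₁ι D C) ≫ C.dom = famObj (natSrc (preNat₁ι D C)) := by
  have h := eqLocus_condition (natApp (𝟙 (preNat₀ D C)) ≫ C.dom)
    (famObj (natSrc (𝟙 (preNat₀ D C))))
  rw [← Category.assoc, natApp_reindex, ← famObj_reindex, natSrc_reindex, Category.comp_id] at h
  exact h

theorem preNat₂_cod : natApp (preNat₂ι D C) ≫ C.cod = famObj (natTgt (preNat₂ι D C)) := by
  have h := eqLocus_condition (natApp (preNat₁ι D C) ≫ C.cod) (famObj (natTgt (preNat₁ι D C)))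
  rw [← Category.assoc, natApp_reindex, ← famObj_reindex, natTgt_reindex] at h
  exact h

theorem preNat₂_dom : natApp (preNat₂ι D C) ≫ C.dom = famObj (natSrc (preNat₂ι D C)) := by
  rw [preNat₂ι, ← natApp_reindex, Category.assoc, preNat₁_dom, ← famObj_reindex, natSrc, natSrc,
    Category.assoc]

/-- On `preNat₂`: the composite along one side of the naturality square. -/
noncomputable abbrev natL :
    D.mor ⊗ preNat₂ D C ⟶ C.mor :=
  C.compose (famMor (natSrc (preNat₂ι D C))) (D.cod ▷ _ ≫ natApp (preNat₂ι D C))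
    (by rw [(isFunctorFamily_fam _).mor_cod, Category.assoc, preNat₂_dom])

/-- On `preNat₂`: the composite along the other side of the naturality square. -/
noncomputable abbrev natR :
    D.mor ⊗ preNat₂ D C ⟶ C.mor :=
  C.compose (D.dom ▷ _ ≫ natApp (preNat₂ι D C)) (famMor (natTgt (preNat₂ι D C)))
    (by rw [(isFunctorFamily_fam _).mor_dom, Category.assoc, preNat₂_cod])

/-- The object of natural transformations between internal functors `D → C`: the subobject of
`preNat₂` of triples that satisfy naturality. -/
noncomputable def natObj : E := eqLocus (natL D C) (natR D C)

/-- The inclusion of the object of natural transformations in `preNat₂`. -/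
noncomputable def natObjj : natObj D C ⟶ preNat₂ D C := eqLocusι _ _

/-- The inclusion of the object of natural transformations in the object of triples. -/
noncomputable def natObjι : natObj D C ⟶ preNat₀ D C := natObjj D C ≫ preNat₂ι D C

instance : Mono (preNat₁ι D C) := inferInstanceAs (Mono (eqLocusι _ _))

instance : Mono (preNat₂j D C) := inferInstanceAs (Mono (eqLocusι _ _))

instance : Mono (natObjj D C) := inferInstanceAs (Mono (eqLocusι _ _))

instance : Mono (natObjι D C) := by
  unfold natObjι preNat₂ι; infer_instance

/-- The source of a natural transformation. -/
noncomputable def natDom : natObj D C ⟶ funObj D C := natSrc (natObjι D C)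

/-- The target of a natural transformation. -/
noncomputable def natCod : natObj D C ⟶ funObj D C := natTgt (natObjι D C)

variable {D C}

/-- The universal family of natural transformations, pulled back along `α : T ⟶ natObj D C`. -/
noncomputable def famApp {T : E} (α : T ⟶ natObj D C) : D.obj ⊗ T ⟶ C.mor :=
  natApp (α ≫ natObjι D C)

theorem famApp_reindex {S T : E} (t : S ⟶ T) (α : T ⟶ natObj D C) :
    famApp (t ≫ α) = D.obj ◁ t ≫ famApp α := by
  rw [famApp, famApp, natApp_reindex, Category.assoc]

theorem isNatTransFamily_univ :
    IsNatTransFamily D C (isFunctorFamily_fam (natDom D C)) (isFunctorFamily_fam (natCod D C))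
      (natApp (natObjι D C)) where
  app_dom := by
    rw [natObjι, ← natApp_reindex, Category.assoc, preNat₂_dom, ← famObj_reindex,
      natSrc_reindex]
    rfl
  app_cod := by
    rw [natObjι, ← natApp_reindex, Category.assoc, preNat₂_cod, ← famObj_reindex,
      natTgt_reindex]
    rfl
  naturality := by
    have h := eqLocus_condition (natL D C) (natR D C)
    rw [natL, natR, comp_compose, comp_compose] at h
    refine ((compose_congr ?_ ?_ _).trans h).trans (compose_congr ?_ ?_ _)
    · rw [← famMor_reindex, natSrc_reindex]; rfl
    · rw [whisker_exchange_assoc, natApp_reindex, natObjι]; rfl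
    · rw [whisker_exchange_assoc, natApp_reindex, natObjι]; rfl
    · rw [← famMor_reindex, natTgt_reindex]; rfl

theorem isNatTransFamily_fam {T : E} (α : T ⟶ natObj D C) {F G : T ⟶ funObj D C}
    (hF : α ≫ natDom D C = F) (hG : α ≫ natCod D C = G) :
    IsNatTransFamily D C (isFunctorFamily_fam F) (isFunctorFamily_fam G) (famApp α) := by
  subst hF hG
  exact isNatTransFamily_congr ((isNatTransFamily_univ (D := D) (C := C)).reindex α)
    (famObj_reindex _ _).symm (famMor_reindex _ _).symm (famObj_reindex _ _).symm
    (famMor_reindex _ _).symm (natApp_reindex _ _) _ _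

/-- Every `T`-indexed family of natural transformations is classified by a map to `natObj`. -/
theorem exists_natLift {T : E} (F G : T ⟶ funObj D C) (α : D.obj ⊗ T ⟶ C.mor)
    (h : IsNatTransFamily D C (isFunctorFamily_fam F) (isFunctorFamily_fam G) α) :
    ∃ t : T ⟶ natObj D C, t ≫ natObjι D C = lift (lift F G) (curry α) := by
  have eF : natSrc (lift (lift F G) (curry α)) = F := by simp [natSrc]
  have eG : natTgt (lift (lift F G) (curry α)) = G := by simp [natTgt]
  have eα : natApp (lift (lift F G) (curry α)) = α := by simp [natApp]
  generalize lift (lift F G) (curry α) = i at eF eG eα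
  subst eF eG eα
  obtain ⟨t₁, ht₁⟩ : ∃ t, t ≫ preNat₁ι D C = i := by
    apply eqLocus_factor
    rw [← Category.assoc, natApp_reindex, ← famObj_reindex, Category.comp_id, h.app_dom, natSrc,
      natSrc, Category.id_comp]
  obtain ⟨t₂, ht₂⟩ : ∃ t, t ≫ preNat₂j D C = t₁ := by
    apply eqLocus_factor
    rw [← Category.assoc, natApp_reindex, ← famObj_reindex, ht₁, h.app_cod, natTgt, natTgt,
      ← Category.assoc t₁, ht₁]
  have hi₂ : t₂ ≫ preNat₂ι D C = i := by rw [preNat₂ι, ← Category.assoc, ht₂, ht₁]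
  obtain ⟨t₃, ht₃⟩ : ∃ t, t ≫ natObjj D C = t₂ := by
    apply eqLocus_factor
    rw [natL, natR, comp_compose, comp_compose]
    refine ((compose_congr ?_ ?_ _).trans h.naturality).trans (compose_congr ?_ ?_ _)
    · rw [← famMor_reindex, natSrc, natSrc, ← Category.assoc t₂, hi₂]
    · rw [whisker_exchange_assoc, natApp_reindex, hi₂]
    · rw [whisker_exchange_assoc, natApp_reindex, hi₂]
    · rw [← famMor_reindex, natTgt, natTgt, ← Category.assoc t₂, hi₂]
  exact ⟨t₃, by rw [natObjι, ← Category.assoc, ht₃, hi₂]⟩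

/-- The map to `natObj` that classifies a `T`-indexed family of natural transformations. -/
noncomputable def natLift {T : E} (F G : T ⟶ funObj D C) (α : D.obj ⊗ T ⟶ C.mor)
    (h : IsNatTransFamily D C (isFunctorFamily_fam F) (isFunctorFamily_fam G) α) :
    T ⟶ natObj D C :=
  (exists_natLift F G α h).choose

theorem natLift_dom {T : E} (F G : T ⟶ funObj D C) (α : D.obj ⊗ T ⟶ C.mor)
    (h : IsNatTransFamily D C (isFunctorFamily_fam F) (isFunctorFamily_fam G) α) :
    natLift F G α h ≫ natDom D C = F := by
  rw [natDom, natSrc, ← Category.assoc, natLift, (exists_natLift F G α h).choose_spec]; simp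

theorem natLift_cod {T : E} (F G : T ⟶ funObj D C) (α : D.obj ⊗ T ⟶ C.mor)
    (h : IsNatTransFamily D C (isFunctorFamily_fam F) (isFunctorFamily_fam G) α) :
    natLift F G α h ≫ natCod D C = G := by
  rw [natCod, natTgt, ← Category.assoc, natLift, (exists_natLift F G α h).choose_spec]; simp

theorem famApp_natLift {T : E} (F G : T ⟶ funObj D C) (α : D.obj ⊗ T ⟶ C.mor)
    (h : IsNatTransFamily D C (isFunctorFamily_fam F) (isFunctorFamily_fam G) α) :
    famApp (natLift F G α h) = α := by
  rw [famApp, natApp, natLift, (exists_natLift F G α h).choose_spec, lift_snd, uncurry_curry]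

theorem natObj_hom_ext {T : E} {α β : T ⟶ natObj D C} (hd : α ≫ natDom D C = β ≫ natDom D C)
    (hc : α ≫ natCod D C = β ≫ natCod D C) (h : famApp α = famApp β) : α = β := by
  rw [← cancel_mono (natObjι D C)]
  refine CartesianMonoidalCategory.hom_ext _ _ (CartesianMonoidalCategory.hom_ext _ _ ?_ ?_)
    (uncurry_injective h)
  · simpa [natDom, natSrc] using hd
  · simpa [natCod, natTgt] using hc

/-! #### The functor category -/

/-- Vertical composition of two composable generalized natural transformations. -/
noncomputable def natComp {T : E} (α β : T ⟶ natObj D C) (h : α ≫ natCod D C = β ≫ natDom D C) :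
    T ⟶ natObj D C :=
  natLift (α ≫ natDom D C) (β ≫ natCod D C)
    (C.compose (famApp α) (famApp β)
      ((isNatTransFamily_fam α rfl rfl).app_cod.trans
        ((isNatTransFamily_fam β h.symm rfl).app_dom).symm))
    ((isNatTransFamily_fam α rfl rfl).composite (isNatTransFamily_fam β h.symm rfl))

theorem natComp_dom {T : E} (α β : T ⟶ natObj D C) (h : α ≫ natCod D C = β ≫ natDom D C) :
    natComp α β h ≫ natDom D C = α ≫ natDom D C := natLift_dom _ _ _ _

theorem natComp_cod {T : E} (α β : T ⟶ natObj D C) (h : α ≫ natCod D C = β ≫ natDom D C) :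
    natComp α β h ≫ natCod D C = β ≫ natCod D C := natLift_cod _ _ _ _

theorem famApp_natComp {T : E} (α β : T ⟶ natObj D C) (h : α ≫ natCod D C = β ≫ natDom D C) :
    famApp (natComp α β h) = C.compose (famApp α) (famApp β)
      ((isNatTransFamily_fam α rfl rfl).app_cod.trans
        ((isNatTransFamily_fam β h.symm rfl).app_dom).symm) := famApp_natLift _ _ _ _

theorem comp_natComp {S T : E} (t : S ⟶ T) (α β : T ⟶ natObj D C)
    (h : α ≫ natCod D C = β ≫ natDom D C) :
    t ≫ natComp α β h = natComp (t ≫ α) (t ≫ β) (by simp [h]) := by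
  apply natObj_hom_ext
  · rw [natComp_dom, Category.assoc, natComp_dom, Category.assoc]
  · rw [natComp_cod, Category.assoc, natComp_cod, Category.assoc]
  · rw [famApp_reindex, famApp_natComp, famApp_natComp, comp_compose]
    exact compose_congr (famApp_reindex _ _).symm (famApp_reindex _ _).symm _

/-- The identity natural transformation of a functor. -/
noncomputable def natId (D C : InternalCategory E) : funObj D C ⟶ natObj D C :=
  natLift (𝟙 _) (𝟙 _) (famObj (𝟙 _) ≫ C.id) (IsNatTransFamily.identity _)

theorem natId_dom : natId D C ≫ natDom D C = 𝟙 _ := natLift_dom _ _ _ _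

theorem natId_cod : natId D C ≫ natCod D C = 𝟙 _ := natLift_cod _ _ _ _

theorem famApp_natId {T : E} (F : T ⟶ funObj D C) :
    famApp (F ≫ natId D C) = famObj F ≫ C.id := by
  rw [famApp_reindex, natId, famApp_natLift, ← Category.assoc, ← famObj_reindex, Category.comp_id]

theorem lift_natComp {T : E} (α β : T ⟶ natObj D C) (h : α ≫ natCod D C = β ≫ natDom D C) :
    pullback.lift α β h ≫ natComp (pullback.fst (natCod D C) (natDom D C))
      (pullback.snd (natCod D C) (natDom D C)) pullback.condition = natComp α β h := by
  have e₁ := pullback.lift_fst α β h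
  have e₂ := pullback.lift_snd α β h
  rw [comp_natComp]
  generalize_proofs
  simp only [e₁, e₂]

/-- The internal functor category `C ^ D`: its objects are the internal functors `D → C`, its
morphisms the internal natural transformations between them. -/
noncomputable def functorCategory (D C : InternalCategory E) : InternalCategory E where
  obj := funObj D C
  mor := natObj D C
  dom := natDom D C
  cod := natCod D C
  id := natId D C
  comp := natComp (pullback.fst (natCod D C) (natDom D C))
    (pullback.snd (natCod D C) (natDom D C)) pullback.condition
  id_dom := natId_dom
  id_cod := natId_cod
  comp_dom := natComp_dom _ _ _
  comp_cod := natComp_cod _ _ _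
  id_comp := by
    rw [lift_natComp]
    apply natObj_hom_ext
    · rw [natComp_dom, Category.assoc, natId_dom, Category.id_comp, Category.comp_id]
    · rw [natComp_cod]
    · rw [famApp_natComp, compose_congr (famApp_natId _) rfl]
      exact C.id_compose _ _ (isNatTransFamily_fam _ (by simp) rfl).app_dom.symm
  comp_id := by
    rw [lift_natComp]
    apply natObj_hom_ext
    · rw [natComp_dom]
    · rw [natComp_cod, Category.assoc, natId_cod, Category.id_comp, Category.comp_id]
    · rw [famApp_natComp, compose_congr rfl (famApp_natId _)]
      exact C.compose_id _ _ (isNatTransFamily_fam _ rfl (by simp)).app_cod.symm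
  assoc := by
    intro T f g h hfg hgh
    simp only [lift_natComp]
    apply natObj_hom_ext
    · simp only [natComp_dom]
    · simp only [natComp_cod]
    · simp only [famApp_natComp]
      exact C.compose_assoc _ _ _ _ _

/-- The map that sends an object of `C` to the constant functor at that object. -/
noncomputable def diagObj (D C : InternalCategory E) : C.obj ⟶ funObj D C :=
  funLift (IsFunctorFamily.const (𝟙 C.obj))

theorem famObj_diagObj {T : E} (x : T ⟶ C.obj) : famObj (x ≫ diagObj D C) = snd D.obj T ≫ x := by
  rw [famObj_reindex, diagObj, famObj_funLift, Category.comp_id, whiskerLeft_snd]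

theorem famMor_diagObj {T : E} (x : T ⟶ C.obj) :
    famMor (x ≫ diagObj D C) = snd D.mor T ≫ x ≫ C.id := by
  rw [famMor_reindex, diagObj, famMor_funLift, Category.id_comp, whiskerLeft_snd_assoc]

/-- The map that sends a morphism of `C` to the constant natural transformation. -/
noncomputable def diagMor (D C : InternalCategory E) : C.mor ⟶ natObj D C :=
  natLift (C.dom ≫ diagObj D C) (C.cod ≫ diagObj D C) (snd D.obj C.mor)
    (isNatTransFamily_congr (IsNatTransFamily.const (𝟙 C.mor))
      (by rw [famObj_diagObj, Category.id_comp]) (by rw [famMor_diagObj, Category.id_comp])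
      (by rw [famObj_diagObj, Category.id_comp]) (by rw [famMor_diagObj, Category.id_comp])
      (Category.comp_id _) _ _)

theorem diagMor_dom : diagMor D C ≫ natDom D C = C.dom ≫ diagObj D C := natLift_dom _ _ _ _

theorem diagMor_cod : diagMor D C ≫ natCod D C = C.cod ≫ diagObj D C := natLift_cod _ _ _ _

theorem famApp_diagMor {T : E} (f : T ⟶ C.mor) : famApp (f ≫ diagMor D C) = snd D.obj T ≫ f := by
  rw [famApp_reindex, diagMor, famApp_natLift, whiskerLeft_snd]

theorem id_diagMor : C.id ≫ diagMor D C = diagObj D C ≫ natId D C := by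
  apply natObj_hom_ext
  · rw [Category.assoc, diagMor_dom, reassoc_of% C.id_dom, Category.assoc, natId_dom,
      Category.comp_id]
  · rw [Category.assoc, diagMor_cod, reassoc_of% C.id_cod, Category.assoc, natId_cod,
      Category.comp_id]
  · rw [famApp_natId, famApp_diagMor, ← Category.id_comp (diagObj D C), famObj_diagObj,
      Category.comp_id]

theorem compose_diagMor {T : E} (f g : T ⟶ C.mor) (h : f ≫ C.cod = g ≫ C.dom) :
    C.compose f g h ≫ diagMor D C = natComp (f ≫ diagMor D C) (g ≫ diagMor D C)
      (by rw [Category.assoc, Category.assoc, diagMor_cod, diagMor_dom, reassoc_of% h]) := by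
  apply natObj_hom_ext
  · rw [natComp_dom, Category.assoc, diagMor_dom, ← Category.assoc, compose_dom, Category.assoc,
      Category.assoc, diagMor_dom]
  · rw [natComp_cod, Category.assoc, diagMor_cod, ← Category.assoc, compose_cod, Category.assoc,
      Category.assoc, diagMor_cod]
  · rw [famApp_natComp, famApp_diagMor, comp_compose]
    exact compose_congr (famApp_diagMor _).symm (famApp_diagMor _).symm _

/-- The internal functor `C → C ^ D` that sends objects and morphisms to constant functors and
constant natural transformations. -/
noncomputable def diagonal (D C : InternalCategory E) :
    InternalFunctor C (functorCategory D C) where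
  obj := diagObj D C
  mor := diagMor D C
  mor_dom := diagMor_dom
  mor_cod := diagMor_cod
  map_id := id_diagMor
  map_comp := by
    have h : C.comp = C.compose (pullback.fst C.cod C.dom) (pullback.snd C.cod C.dom)
        pullback.condition := by
      rw [compose, pullback.lift_fst_snd, Category.id_comp]
    exact ((congrArg (· ≫ diagMor D C) h).trans (compose_diagMor _ _ _)).trans
      (lift_natComp _ _ _).symm

/-- `C` is complete (relative to `E`): for every internal category `D` of `E`, the diagonal
`C → C ^ D` has an internal right adjoint. -/
def IsComplete (C : InternalCategory E) : Prop :=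
  ∀ D : InternalCategory E, ∃ lim : InternalFunctor (functorCategory D C) C,
    Nonempty (InternalAdjunction (diagonal D C) lim)

end FunctorCategory

end InternalCategory

/-! ### Algebras -/

namespace InternalFunctor

variable {E : Type u} [Category.{v} E] [HasPullbacks E] {C : InternalCategory E}
  (F : InternalFunctor C C)

/-- A `T`-indexed family of algebras for the internal endofunctor `F`: a family of objects `x` of
`C` and a family of morphisms `F x → x`. -/
structure Alg (T : E) where
  carrier : T ⟶ C.obj
  str : T ⟶ C.mor
  str_dom : str ≫ C.dom = carrier ≫ F.obj
  str_cod : str ≫ C.cod = carrier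

variable {F}

/-- Reindexing of a family of algebras. -/
def Alg.reindex {S T : E} (A : F.Alg T) (t : S ⟶ T) : F.Alg S where
  carrier := t ≫ A.carrier
  str := t ≫ A.str
  str_dom := by rw [Category.assoc, A.str_dom, Category.assoc]
  str_cod := by rw [Category.assoc, A.str_cod]

/-- A `T`-indexed family `h` of morphisms of algebras: it satisfies `str_A ; h = F h ; str_B`. -/
structure Alg.IsHom {T : E} (A B : F.Alg T) (h : T ⟶ C.mor) : Prop where
  hom_dom : h ≫ C.dom = A.carrier
  hom_cod : h ≫ C.cod = B.carrier
  comm : C.compose A.str h (by rw [A.str_cod, hom_dom]) =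
    C.compose (h ≫ F.mor) B.str
      (by rw [Category.assoc, F.mor_cod, reassoc_of% hom_cod, B.str_dom])

/-- A global algebra is initial if every family of algebras, over any object `T` of `E`, receives
exactly one family of algebra morphisms from it. -/
def Alg.IsInitial [CartesianMonoidalCategory E] (A : F.Alg (𝟙_ E)) : Prop :=
  ∀ (T : E) (B : F.Alg T), ∃! h : T ⟶ C.mor, (A.reindex (toUnit T)).IsHom B h

end InternalFunctor

/-- `C` is algebraically complete: every internal endofunctor of `C` has an initial algebra. -/
def InternalCategory.IsAlgebraicallyComplete {E : Type u} [Category.{v} E] [HasPullbacks E]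
    [CartesianMonoidalCategory E] (C : InternalCategory E) : Prop :=
  ∀ F : InternalFunctor C C, ∃ A : F.Alg (𝟙_ E), A.IsInitial

/-! An initial algebra is the vertex of a limit of the forgetful functor `U` from `F`-algebras to
`C`. With finite limits in `E`, the algebras and their morphisms form an internal category
`algCategory`, so completeness applies to it without any size obstruction and yields a limit cone
`π` over `U` with a global vertex `L` (`IsComplete.exists_isLimitCone`).

Applying `F` to `π` and composing with the structure maps gives a cone with vertex `F L`
(`IsCone.algCone`). Its factorization through `π` is a map `c : F L → L`, and the equation of this
factorization says that `c` is an algebra structure for which every component of `π` is an algebra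
morphism. Hence `A = (L, c)` maps to every algebra.

For uniqueness, the component `π_A : L → L` is considered. Since `π` consists of algebra morphisms
out of `A`, naturality of the cone gives `π_A ; π_B = π_B` for all `B`, so `π_A` is the identity by
uniqueness of factorizations. For any algebra morphism `h : A → B`, naturality at `h` gives `π_A ; h
= π_B`, that is `h = π_B`.

The universal property of the limit is used only for cones with global vertex. Algebras indexed by
an arbitrary `T` are reached by pulling back the universal algebra over `algObj` and the naturality
equation over `algMor`. -/

section General

variable {E : Type u} [Category.{v} E] [HasPullbacks E] {C D : InternalCategory E}

/-- Naturality at a generalized morphism. -/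
theorem InternalNatTrans.naturality_at {F G : InternalFunctor C D} (α : InternalNatTrans F G)
    {T : E} {x y : T ⟶ C.obj} (f : T ⟶ C.mor) (hx : f ≫ C.dom = x) (hy : f ≫ C.cod = y) :
    D.compose (f ≫ F.mor) (y ≫ α.app)
        (by rw [← hy, Category.assoc, F.mor_cod, Category.assoc, Category.assoc, α.app_dom]) =
      D.compose (x ≫ α.app) (f ≫ G.mor)
        (by rw [← hx, Category.assoc, Category.assoc, Category.assoc, G.mor_dom, α.app_cod]) := by
  subst hx hy
  have h := congrArg (f ≫ ·) α.naturality
  simpa only [InternalCategory.comp_compose, Category.assoc] using h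

/-! ### Transposition across an internal adjunction, for generalized elements. -/

namespace InternalAdjunction

variable {F : InternalFunctor C D} {G : InternalFunctor D C}

theorem unit_dom (adj : InternalAdjunction F G) : adj.unit.app ≫ C.dom = 𝟙 _ :=
  adj.unit.app_dom

theorem unit_cod (adj : InternalAdjunction F G) : adj.unit.app ≫ C.cod = F.obj ≫ G.obj :=
  adj.unit.app_cod

theorem counit_dom (adj : InternalAdjunction F G) : adj.counit.app ≫ D.dom = G.obj ≫ F.obj :=
  adj.counit.app_dom

theorem counit_cod (adj : InternalAdjunction F G) : adj.counit.app ≫ D.cod = 𝟙 _ :=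
  adj.counit.app_cod

/-- Every generalized morphism `F x → y` factors through the counit at `y`. -/
theorem exists_transpose (adj : InternalAdjunction F G) {T : E} (x : T ⟶ C.obj) (y : T ⟶ D.obj)
    (α : T ⟶ D.mor) (hx : α ≫ D.dom = x ≫ F.obj) (hy : α ≫ D.cod = y) :
    ∃ (β : T ⟶ C.mor) (_ : β ≫ C.dom = x) (hc : β ≫ C.cod = y ≫ G.obj),
      D.compose (β ≫ F.mor) (y ≫ adj.counit.app)
        (by rw [Category.assoc, F.mor_cod, reassoc_of% hc, Category.assoc, adj.counit_dom]) =
          α := by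
  have e : (x ≫ adj.unit.app) ≫ C.cod = (α ≫ G.mor) ≫ C.dom := by
    rw [Category.assoc, Category.assoc, G.mor_dom, reassoc_of% hx, adj.unit_cod]
  -- The usual transpose: the unit at `x` followed by `G α`.
  refine ⟨C.compose (x ≫ adj.unit.app) (α ≫ G.mor) e, ?_, ?_, ?_⟩
  · rw [InternalCategory.compose_dom, Category.assoc, adj.unit_dom, Category.comp_id]
  · rw [InternalCategory.compose_cod, Category.assoc, G.mor_cod, reassoc_of% hy]
  · have h₁ := adj.counit.naturality_at α hx hy
    have h₂ := congrArg (x ≫ ·) adj.left_triangle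
    simp only [InternalCategory.comp_compose, InternalFunctor.comp, InternalFunctor.identity,
      Category.assoc, Category.comp_id] at h₁ h₂
    simp only [F.compose_mor, Category.assoc]
    -- In diagrammatic order, with unit `η` and counit `ε`: `Fη ; (FGα ; ε) = Fη ; (ε ; α) = (Fη ;
    -- ε) ; α = α`, by naturality of `ε` and the left triangle.
    rw [D.compose_assoc, InternalCategory.compose_congr rfl h₁, ← D.compose_assoc,
      InternalCategory.compose_congr h₂ rfl]
    · simpa only [Category.assoc] using D.id_compose (x ≫ F.obj) α hx.symm
    · simp only [Category.assoc, F.mor_cod, adj.counit_dom]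
      rw [reassoc_of% adj.unit_cod]
    · simp only [Category.assoc, F.mor_cod, adj.counit_dom]
      rw [reassoc_of% G.mor_cod, reassoc_of% hy]

/-- A generalized morphism into `G y` is determined by its transpose. -/
theorem eq_of_transpose_eq (adj : InternalAdjunction F G) {T : E} {y : T ⟶ D.obj}
    {β β' : T ⟶ C.mor} (hd : β ≫ C.dom = β' ≫ C.dom) (hc : β ≫ C.cod = y ≫ G.obj)
    (hc' : β' ≫ C.cod = y ≫ G.obj)
    (h : D.compose (β ≫ F.mor) (y ≫ adj.counit.app)
        (by rw [Category.assoc, F.mor_cod, reassoc_of% hc, Category.assoc, adj.counit_dom]) =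
      D.compose (β' ≫ F.mor) (y ≫ adj.counit.app)
        (by rw [Category.assoc, F.mor_cod, reassoc_of% hc', Category.assoc, adj.counit_dom])) :
    β = β' := by
  -- Transposition has a left inverse: `γ` is the unit at its domain followed by `G` of its
  -- transpose, by naturality of the unit and the right triangle. So the domain and the transpose
  -- determine `γ`.
  have key : ∀ (γ : T ⟶ C.mor) (hγ : γ ≫ C.cod = y ≫ G.obj),
      C.compose (γ ≫ C.dom ≫ adj.unit.app)
        (D.compose (γ ≫ F.mor) (y ≫ adj.counit.app)
          (by rw [Category.assoc, F.mor_cod, reassoc_of% hγ, Category.assoc, adj.counit_dom]) ≫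
            G.mor)
        (by
          rw [Category.assoc, Category.assoc, adj.unit_cod, Category.assoc, G.mor_dom,
            ← Category.assoc _ D.dom, InternalCategory.compose_dom]
          simp only [Category.assoc]
          rw [reassoc_of% F.mor_dom]) = γ := by
    intro γ hγ
    have h₁ := adj.unit.naturality_at γ rfl hγ
    have h₂ := congrArg (y ≫ ·) adj.right_triangle
    simp only [InternalCategory.comp_compose, InternalFunctor.comp, InternalFunctor.identity,
      Category.assoc, Category.comp_id] at h₁ h₂
    simp only [G.compose_mor, Category.assoc]
    rw [← C.compose_assoc, InternalCategory.compose_congr h₁.symm rfl, C.compose_assoc,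
      InternalCategory.compose_congr rfl h₂]
    · simpa only [Category.assoc] using C.compose_id (y ≫ G.obj) γ hγ.symm
    · simp only [Category.assoc, G.mor_dom, adj.unit_cod]
      rw [reassoc_of% adj.counit_dom]
    · simp only [Category.assoc, G.mor_dom, adj.unit_cod]
      rw [reassoc_of% F.mor_dom]
  rw [← key β hc, ← key β' hc']
  exact InternalCategory.compose_congr (by rw [reassoc_of% hd]) (by rw [h]) _

end InternalAdjunction

end General

/-! ### Cones and limit cones over a single internal functor. -/

section Limits

variable {E : Type u} [Category.{v} E] [CartesianMonoidalCategory E] [HasPullbacks E]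
  {C D : InternalCategory E}

/-- `σ` is an internal cone over the internal functor `U`, with vertex the global object `x`. -/
structure InternalFunctor.IsCone (U : InternalFunctor D C) (x : 𝟙_ E ⟶ C.obj)
    (σ : D.obj ⟶ C.mor) : Prop where
  app_dom : σ ≫ C.dom = toUnit _ ≫ x
  app_cod : σ ≫ C.cod = U.obj
  naturality : C.compose (D.dom ≫ σ) U.mor (by rw [Category.assoc, app_cod, U.mor_dom]) =
    D.cod ≫ σ

/-- The internal cone `π` over `U` with vertex `L` is a limit cone, among cones with global
vertex. -/
structure InternalFunctor.IsLimitCone (U : InternalFunctor D C) (L : 𝟙_ E ⟶ C.obj)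
    (π : D.obj ⟶ C.mor) : Prop where
  isCone : U.IsCone L π
  exists_lift : ∀ (x : 𝟙_ E ⟶ C.obj) (σ : D.obj ⟶ C.mor), U.IsCone x σ →
    ∃ (β : 𝟙_ E ⟶ C.mor) (_ : β ≫ C.dom = x) (hc : β ≫ C.cod = L),
      C.compose (toUnit _ ≫ β) π (by rw [Category.assoc, hc, isCone.app_dom]) = σ
  lift_unique : ∀ (β β' : 𝟙_ E ⟶ C.mor) (_ : β ≫ C.dom = β' ≫ C.dom) (hc : β ≫ C.cod = L)
    (hc' : β' ≫ C.cod = L),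
    C.compose (toUnit _ ≫ β) π (by rw [Category.assoc, hc, isCone.app_dom]) =
      C.compose (toUnit _ ≫ β') π (by rw [Category.assoc, hc', isCone.app_dom]) → β = β'

end Limits

/-! ### Internal functors as global objects of the functor category, and their limits. -/

namespace InternalCategory

section

variable {E : Type u} [Category.{v} E] [CartesianMonoidalCategory E]

/-- The projection `X ⊗ 𝟙_ E ⟶ X` is invertible, with inverse `lift (𝟙 X) (toUnit X)`. Precomposing
with these two maps translates between families indexed by `𝟙_ E` and plain maps out of `X`. -/
theorem lift_id_toUnit_comp_fst_comp {X Y : E} (f : X ⊗ 𝟙_ E ⟶ Y) :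
    fst X (𝟙_ E) ≫ lift (𝟙 X) (toUnit X) ≫ f = f := by
  have h : fst X (𝟙_ E) ≫ lift (𝟙 X) (toUnit X) = 𝟙 _ := by
    apply CartesianMonoidalCategory.hom_ext
    · simp
    · exact toUnit_unique _ _
  rw [reassoc_of% h]

variable [HasPullbacks E] {C D : InternalCategory E}

/-- An internal functor, as a constant family of functors. -/
theorem isFunctorFamily_functor (U : InternalFunctor D C) (T : E) :
    IsFunctorFamily D C (fst _ T ≫ U.obj) (fst _ T ≫ U.mor) where
  mor_dom := by simp [U.mor_dom]
  mor_cod := by simp [U.mor_cod]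
  map_id := by simp [U.map_id]
  map_comp := by
    rw [whiskerRight_fst_assoc, U.map_comp, comp_compose]
    exact compose_congr (by simp) (by simp) _

end

variable {E : Type u} [Category.{v} E] [CartesianMonoidalCategory E] [HasFiniteLimits E]
  [MonoidalClosed E] {C D : InternalCategory E}

/-- An internal functor, as a global object of the internal functor category. -/
noncomputable def functorName (U : InternalFunctor D C) : 𝟙_ E ⟶ funObj D C :=
  funLift (isFunctorFamily_functor U (𝟙_ E))

theorem famObj_functorName (U : InternalFunctor D C) :
    famObj (functorName U) = fst _ _ ≫ U.obj := famObj_funLift _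

theorem famMor_functorName (U : InternalFunctor D C) :
    famMor (functorName U) = fst _ _ ≫ U.mor := famMor_funLift _

/-- A global object of the natural transformations from a constant functor to `U` is a cone. -/
theorem isCone_of_natTrans (U : InternalFunctor D C) (x : 𝟙_ E ⟶ C.obj)
    (α : 𝟙_ E ⟶ natObj D C) (hd : α ≫ natDom D C = x ≫ diagObj D C)
    (hc : α ≫ natCod D C = functorName U) :
    U.IsCone x (lift (𝟙 _) (toUnit _) ≫ famApp α) := by
  have h := isNatTransFamily_fam α hd hc
  have ed := h.app_dom
  have ec := h.app_cod
  rw [famObj_diagObj] at ed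
  rw [famObj_functorName] at ec
  have en := congrArg (lift (𝟙 _) (toUnit _) ≫ ·) h.naturality
  -- The isomorphism from `X` to `X ⊗ 𝟙_ E` is natural in `X`.
  have ex : ∀ {X Y : E} (f : X ⟶ Y), lift (𝟙 X) (toUnit X) ≫ f ▷ 𝟙_ E =
      f ≫ lift (𝟙 Y) (toUnit Y) := fun f => by
    apply CartesianMonoidalCategory.hom_ext
    · simp
    · exact toUnit_unique _ _
  refine ⟨by simp [ed], by simp [ec], ?_⟩
  simp only [comp_compose, famMor_diagObj, famMor_functorName, reassoc_of% ex, lift_fst_assoc,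
    lift_snd_assoc, Category.id_comp] at en
  rw [← en]
  -- The source functor is constant and sends every morphism to an identity, so one side of the
  -- naturality square collapses to `D.cod ≫ σ`.
  have e := C.id_compose (toUnit D.mor ≫ x) (D.cod ≫ lift (𝟙 _) (toUnit _) ≫ famApp α)
    (by simp [ed])
  simpa only [Category.assoc] using e

/-- A cone over `U` is a global object of the natural transformations from a constant functor
to `U`. -/
theorem exists_natTrans_of_isCone (U : InternalFunctor D C) (x : 𝟙_ E ⟶ C.obj)
    (σ : D.obj ⟶ C.mor) (h : U.IsCone x σ) :
    ∃ α : 𝟙_ E ⟶ natObj D C, α ≫ natDom D C = x ≫ diagObj D C ∧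
      α ≫ natCod D C = functorName U ∧ famApp α = fst _ _ ≫ σ := by
  have key : IsNatTransFamily D C (isFunctorFamily_fam (x ≫ diagObj D C))
      (isFunctorFamily_fam (functorName U)) (fst _ _ ≫ σ) := by
    have hu : ∀ X : E, fst X (𝟙_ E) ≫ toUnit X = snd X (𝟙_ E) := fun _ => toUnit_unique _ _
    have ed : (fst D.obj (𝟙_ E) ≫ σ) ≫ C.dom = famObj (x ≫ diagObj D C) := by
      rw [famObj_diagObj, Category.assoc, h.app_dom, reassoc_of% hu]
    have ec : (fst D.obj (𝟙_ E) ≫ σ) ≫ C.cod = famObj (functorName U) := by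
      rw [famObj_functorName, Category.assoc, h.app_cod]
    refine ⟨ed, ec, ?_⟩
    have en := congrArg (fst D.mor (𝟙_ E) ≫ ·) h.naturality
    simp only [comp_compose] at en
    simp only [famMor_diagObj, famMor_functorName, whiskerRight_fst_assoc]
    rw [en]
    have e := C.id_compose (snd D.mor (𝟙_ E) ≫ x) (fst D.mor (𝟙_ E) ≫ D.cod ≫ σ)
      (by simp [h.app_dom, ← hu])
    simpa only [Category.assoc] using e
  exact ⟨natLift _ _ _ key, natLift_dom _ _ _ _, natLift_cod _ _ _ _, famApp_natLift _ _ _ _⟩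

/-- This turns the conclusions of the adjunction lemmas, which speak of `compose`, into equations
about `natComp`, whose components are known. -/
theorem functorCategory_compose {T : E} (α β : T ⟶ natObj D C)
    (h : α ≫ natCod D C = β ≫ natDom D C) :
    (functorCategory D C).compose α β h = natComp α β h := lift_natComp α β h

/-- Over a complete internal category, every global functor `G` has a universal natural
transformation to it from a constant functor. -/
theorem IsComplete.exists_universal (hC : C.IsComplete) (G : 𝟙_ E ⟶ funObj D C) :
    ∃ (L : 𝟙_ E ⟶ C.obj) (ε : 𝟙_ E ⟶ natObj D C) (hd : ε ≫ natDom D C = L ≫ diagObj D C)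
      (_ : ε ≫ natCod D C = G),
      (∀ (x : 𝟙_ E ⟶ C.obj) (α : 𝟙_ E ⟶ natObj D C), α ≫ natDom D C = x ≫ diagObj D C →
        α ≫ natCod D C = G → ∃ (β : 𝟙_ E ⟶ C.mor) (_ : β ≫ C.dom = x) (h : β ≫ C.cod = L),
          natComp (β ≫ diagMor D C) ε
            (by rw [Category.assoc, diagMor_cod, reassoc_of% h, hd]) = α) ∧
      ∀ (β β' : 𝟙_ E ⟶ C.mor) (_ : β ≫ C.dom = β' ≫ C.dom) (h : β ≫ C.cod = L)
        (h' : β' ≫ C.cod = L),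
        natComp (β ≫ diagMor D C) ε (by rw [Category.assoc, diagMor_cod, reassoc_of% h, hd]) =
          natComp (β' ≫ diagMor D C) ε
            (by rw [Category.assoc, diagMor_cod, reassoc_of% h', hd]) → β = β' := by
  obtain ⟨lim, ⟨adj⟩⟩ := hC D
  -- The ascription presents `G` as a generalized object of `functorCategory D C`, the form the
  -- adjunction expects. The limit vertex is then `lim` at `G`, and the universal transformation is
  -- the counit at `G`.
  let y : 𝟙_ E ⟶ (functorCategory D C).obj := G
  refine ⟨y ≫ lim.obj, y ≫ adj.counit.app, ?_, ?_, ?_, ?_⟩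
  · exact (Category.assoc y _ _).trans
      ((congrArg (y ≫ ·) adj.counit_dom).trans (Category.assoc y _ _).symm)
  · exact (Category.assoc y _ _).trans ((congrArg (y ≫ ·) adj.counit_cod).trans
      (Category.comp_id y))
  · intro x α h₁ h₂
    obtain ⟨β, k₁, k₂, k₃⟩ := adj.exists_transpose x y α h₁ h₂
    exact ⟨β, k₁, k₂, (functorCategory_compose _ _ _).symm.trans k₃⟩
  · intro β β' h₁ h₂ h₃ e
    exact adj.eq_of_transpose_eq (y := y) h₁ h₂ h₃
      ((functorCategory_compose _ _ _).trans (e.trans (functorCategory_compose _ _ _).symm))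

/-- An internal functor to a complete internal category has a limit. -/
theorem IsComplete.exists_isLimitCone (hC : C.IsComplete) (U : InternalFunctor D C) :
    ∃ (L : 𝟙_ E ⟶ C.obj) (π : D.obj ⟶ C.mor), U.IsLimitCone L π := by
  obtain ⟨L, ε, hd, hc, hex, huniq⟩ := hC.exists_universal (functorName U)
  have hcone := isCone_of_natTrans U L ε hd hc
  -- Composing the constant transformation at `β` with `ε` amounts to composing `β` with each leg of
  -- the cone. This one identity transports both existence and uniqueness of factorizations from
  -- transformations to cones.
  have hcomp : ∀ (β : 𝟙_ E ⟶ C.mor) (h : β ≫ C.cod = L),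
      famApp (natComp (β ≫ diagMor D C) ε
        (by rw [Category.assoc, diagMor_cod, reassoc_of% h, hd])) =
        fst _ _ ≫ C.compose (toUnit _ ≫ β) (lift (𝟙 _) (toUnit _) ≫ famApp ε)
          (by rw [Category.assoc, h, hcone.app_dom]) := by
    intro β h
    have hu : fst D.obj (𝟙_ E) ≫ toUnit D.obj = snd D.obj (𝟙_ E) := toUnit_unique _ _
    rw [famApp_natComp, comp_compose]
    exact compose_congr (by rw [famApp_diagMor, reassoc_of% hu])
      (lift_id_toUnit_comp_fst_comp _).symm _
  refine ⟨L, lift (𝟙 _) (toUnit _) ≫ famApp ε, hcone, ?_, ?_⟩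
  · intro x σ hσ
    obtain ⟨α, h₁, h₂, h₃⟩ := exists_natTrans_of_isCone U x σ hσ
    obtain ⟨β, k₁, k₂, k₃⟩ := hex x α h₁ h₂
    refine ⟨β, k₁, k₂, ?_⟩
    have e := congrArg famApp k₃
    rw [hcomp β k₂, h₃] at e
    have e' := congrArg (lift (𝟙 _) (toUnit _) ≫ ·) e
    simpa only [lift_fst_assoc, Category.id_comp] using e'
  · intro β β' k₁ k₂ k₃ e
    refine huniq β β' k₁ k₂ k₃ ?_
    apply natObj_hom_ext
    · simp only [natComp_dom, Category.assoc, diagMor_dom]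
      rw [reassoc_of% k₁]
    · simp only [natComp_cod]
    · rw [hcomp β k₂, hcomp β' k₃, e]

end InternalCategory

namespace InternalFunctor

open InternalCategory

/-! ### Identities, composition and reindexing of algebra morphisms. -/

section Algebras

variable {E : Type u} [Category.{v} E] [HasPullbacks E] {C : InternalCategory E}
  {F : InternalFunctor C C}

theorem Alg.IsHom.identity {T : E} (A : F.Alg T) : A.IsHom A (A.carrier ≫ C.id) where
  hom_dom := by rw [Category.assoc, C.id_dom, Category.comp_id]
  hom_cod := by rw [Category.assoc, C.id_cod, Category.comp_id]
  comm := by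
    have e : (A.carrier ≫ C.id) ≫ F.mor = (A.carrier ≫ F.obj) ≫ C.id := by
      rw [Category.assoc, F.map_id, Category.assoc]
    rw [C.compose_id _ _ A.str_cod.symm, compose_congr e rfl, C.id_compose _ _ A.str_dom.symm]

/-- Two commuting squares are pasted, using that `F` preserves composition. -/
theorem Alg.IsHom.composite {T : E} {A B D : F.Alg T} {h k : T ⟶ C.mor} (hh : A.IsHom B h)
    (hk : B.IsHom D k) : A.IsHom D (C.compose h k (hh.hom_cod.trans hk.hom_dom.symm)) where
  hom_dom := by rw [compose_dom, hh.hom_dom]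
  hom_cod := by rw [compose_cod, hk.hom_cod]
  comm := by
    rw [compose_congr (F.compose_mor _ _ _) rfl, ← C.compose_assoc, compose_congr hh.comm rfl,
      C.compose_assoc, compose_congr rfl hk.comm, C.compose_assoc]
    · rw [B.str_cod, hk.hom_dom]
    · rw [A.str_cod, hh.hom_dom]

theorem Alg.IsHom.reindex {S T : E} {A B : F.Alg T} {h : T ⟶ C.mor} (hh : A.IsHom B h)
    (t : S ⟶ T) : (A.reindex t).IsHom (B.reindex t) (t ≫ h) where
  hom_dom := by rw [Category.assoc, hh.hom_dom]; rfl
  hom_cod := by rw [Category.assoc, hh.hom_cod]; rfl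
  comm := by
    have e := congrArg (t ≫ ·) hh.comm
    simp only [comp_compose] at e
    exact e.trans (compose_congr (Category.assoc _ _ _).symm rfl _)

/-- The carrier is the codomain of the structure map. For this reason `algObj` can be cut out of
`C.mor` by the single equation `dom a = F (cod a)`. -/
theorem Alg.eq_of_str_eq {T : E} {A B : F.Alg T} (h : A.str = B.str) : A = B := by
  obtain ⟨x, a, hd, hc⟩ := A
  obtain ⟨y, b, hd', hc'⟩ := B
  obtain rfl : a = b := h
  obtain rfl : x = y := hc.symm.trans hc'
  rfl

end Algebras

/-! ### The internal category of `F`-algebras and its forgetful functor. -/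

section AlgebraCategory

variable {E : Type u} [Category.{v} E] [HasFiniteLimits E] {C : InternalCategory E}
  (F : InternalFunctor C C)

/-- The object of `F`-algebras. -/
noncomputable abbrev algObj : E := equalizer C.dom (C.cod ≫ F.obj)

/-- The structure map of the universal algebra. -/
noncomputable def algStr : F.algObj ⟶ C.mor := equalizer.ι _ _

instance : Mono F.algStr := equalizer.ι_mono

theorem algStr_dom : F.algStr ≫ C.dom = F.algStr ≫ C.cod ≫ F.obj := equalizer.condition _ _

/-- The universal family of algebras. -/
noncomputable def univAlg : F.Alg F.algObj where
  carrier := F.algStr ≫ C.cod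
  str := F.algStr
  str_dom := by rw [algStr_dom, Category.assoc]
  str_cod := rfl

variable {F} in
/-- The classifying map of a family of algebras. -/
noncomputable def Alg.name {T : E} (A : F.Alg T) : T ⟶ F.algObj :=
  equalizer.lift A.str (by rw [A.str_dom, reassoc_of% A.str_cod])

variable {F} in
theorem Alg.name_algStr {T : E} (A : F.Alg T) : A.name ≫ F.algStr = A.str :=
  equalizer.lift_ι _ _

variable {F} in
-- Every family of algebras is a pullback of the universal one, so facts about `univAlg` specialize
-- to all families.
theorem Alg.univAlg_reindex_name {T : E} (A : F.Alg T) : F.univAlg.reindex A.name = A :=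
  Alg.eq_of_str_eq A.name_algStr

theorem univAlg_reindex_id : F.univAlg.reindex (𝟙 _) = F.univAlg :=
  Alg.eq_of_str_eq (Category.id_comp _)

/-- The object of triples of two algebras and a morphism between their carriers. -/
noncomputable abbrev preAlgMor : E :=
  pullback (pullback.snd F.univAlg.carrier C.dom ≫ C.cod) F.univAlg.carrier

/-- The source algebra of a triple. -/
noncomputable def preAlgDom : F.preAlgMor ⟶ F.algObj := pullback.fst _ _ ≫ pullback.fst _ _

/-- The target algebra of a triple. -/
noncomputable def preAlgCod : F.preAlgMor ⟶ F.algObj := pullback.snd _ _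

/-- The underlying morphism of a triple. -/
noncomputable def preAlgApp : F.preAlgMor ⟶ C.mor := pullback.fst _ _ ≫ pullback.snd _ _

theorem preAlgApp_dom : F.preAlgApp ≫ C.dom = F.preAlgDom ≫ F.univAlg.carrier := by
  rw [preAlgApp, preAlgDom, Category.assoc, Category.assoc, pullback.condition]

theorem preAlgApp_cod : F.preAlgApp ≫ C.cod = F.preAlgCod ≫ F.univAlg.carrier := by
  rw [preAlgApp, preAlgCod, Category.assoc, pullback.condition]

/-- The object of morphisms of `F`-algebras. -/
noncomputable abbrev algMor : E :=
  equalizer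
    (C.compose (F.preAlgDom ≫ F.algStr) F.preAlgApp (by rw [preAlgApp_dom, Category.assoc]; rfl))
    (C.compose (F.preAlgApp ≫ F.mor) (F.preAlgCod ≫ F.algStr)
      (by
        rw [Category.assoc, F.mor_cod, reassoc_of% F.preAlgApp_cod, Category.assoc, algStr_dom,
          univAlg, Category.assoc]))

/-- The inclusion of the object of algebra morphisms in the object of triples. -/
noncomputable def algMorι : F.algMor ⟶ F.preAlgMor := equalizer.ι _ _

instance : Mono F.algMorι := equalizer.ι_mono

/-- The source of an algebra morphism. -/
noncomputable def algDom : F.algMor ⟶ F.algObj := F.algMorι ≫ F.preAlgDom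

/-- The target of an algebra morphism. -/
noncomputable def algCod : F.algMor ⟶ F.algObj := F.algMorι ≫ F.preAlgCod

/-- The underlying morphism of an algebra morphism. -/
noncomputable def algApp : F.algMor ⟶ C.mor := F.algMorι ≫ F.preAlgApp

/-- The universal algebra morphism; by `exists_algMorLift` every algebra morphism between pullbacks
of `univAlg` is a pullback of it. -/
theorem isHom_algApp : (F.univAlg.reindex F.algDom).IsHom (F.univAlg.reindex F.algCod)
    F.algApp where
  hom_dom := by rw [algApp, Category.assoc, preAlgApp_dom, ← Category.assoc]; rfl
  hom_cod := by rw [algApp, Category.assoc, preAlgApp_cod, ← Category.assoc]; rfl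
  comm := by
    have e : F.algMorι ≫ C.compose _ _ _ = F.algMorι ≫ C.compose _ _ _ := equalizer.condition _ _
    rw [comp_compose, comp_compose] at e
    refine (compose_congr ?_ rfl _).trans (e.trans (compose_congr ?_ ?_ _))
    · exact Category.assoc _ _ _
    · exact (Category.assoc _ _ _).symm
    · exact (Category.assoc _ _ _).symm

theorem algApp_dom : F.algApp ≫ C.dom = (F.algDom ≫ F.algStr) ≫ C.cod :=
  F.isHom_algApp.hom_dom.trans (Category.assoc _ _ _).symm

theorem algApp_cod : F.algApp ≫ C.cod = (F.algCod ≫ F.algStr) ≫ C.cod :=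
  F.isHom_algApp.hom_cod.trans (Category.assoc _ _ _).symm

theorem algApp_mor_cod : (F.algApp ≫ F.mor) ≫ C.cod = (F.algCod ≫ F.algStr) ≫ C.dom := by
  simp only [Category.assoc, F.mor_cod, algStr_dom]
  rw [reassoc_of% F.algApp_cod]

theorem algApp_comm : C.compose (F.algDom ≫ F.algStr) F.algApp F.algApp_dom.symm =
    C.compose (F.algApp ≫ F.mor) (F.algCod ≫ F.algStr) F.algApp_mor_cod := F.isHom_algApp.comm

variable {F}

/-- The endpoints are variables tied by equations, so that for composable `m` and `n` the middle
algebra can be chosen literally the same, as `Alg.IsHom.composite` requires. -/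
theorem isHom_comp_algApp {T : E} (m : T ⟶ F.algMor) {a b : T ⟶ F.algObj}
    (ha : m ≫ F.algDom = a) (hb : m ≫ F.algCod = b) :
    (F.univAlg.reindex a).IsHom (F.univAlg.reindex b) (m ≫ F.algApp) := by
  subst ha hb
  have e := F.isHom_algApp.reindex m
  rwa [show (F.univAlg.reindex F.algDom).reindex m = F.univAlg.reindex (m ≫ F.algDom) from
      Alg.eq_of_str_eq (Category.assoc _ _ _).symm,
    show (F.univAlg.reindex F.algCod).reindex m = F.univAlg.reindex (m ≫ F.algCod) from
      Alg.eq_of_str_eq (Category.assoc _ _ _).symm] at e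

/-- `algMor` is a subobject of an iterated pullback. Through this lemma the category laws of
`algCategory` reduce to those of `C`. -/
theorem algMor_hom_ext {T : E} {m n : T ⟶ F.algMor} (hd : m ≫ F.algDom = n ≫ F.algDom)
    (hc : m ≫ F.algCod = n ≫ F.algCod) (h : m ≫ F.algApp = n ≫ F.algApp) : m = n := by
  rw [← cancel_mono F.algMorι]
  apply pullback.hom_ext
  · apply pullback.hom_ext
    · simpa only [algDom, preAlgDom, Category.assoc] using hd
    · simpa only [algApp, preAlgApp, Category.assoc] using h
  · simpa only [algCod, preAlgCod, Category.assoc] using hc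

theorem exists_algMorLift {T : E} {a b : T ⟶ F.algObj} {h : T ⟶ C.mor}
    (hh : (F.univAlg.reindex a).IsHom (F.univAlg.reindex b) h) :
    ∃ m : T ⟶ F.algMor, m ≫ F.algDom = a ∧ m ≫ F.algCod = b ∧ m ≫ F.algApp = h := by
  have hd : a ≫ F.univAlg.carrier = h ≫ C.dom := hh.hom_dom.symm
  have hc : h ≫ C.cod = b ≫ F.univAlg.carrier := hh.hom_cod
  obtain ⟨p, hp₁, hp₂, hp₃⟩ : ∃ p : T ⟶ F.preAlgMor,
      p ≫ F.preAlgDom = a ∧ p ≫ F.preAlgCod = b ∧ p ≫ F.preAlgApp = h :=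
    ⟨pullback.lift (pullback.lift a h hd) b (by rw [pullback.lift_snd_assoc, hc]),
      by rw [preAlgDom, pullback.lift_fst_assoc, pullback.lift_fst],
      by rw [preAlgCod, pullback.lift_snd],
      by rw [preAlgApp, pullback.lift_fst_assoc, pullback.lift_snd]⟩
  obtain ⟨m, hm⟩ : ∃ m : T ⟶ F.algMor, m ≫ F.algMorι = p := by
    refine ⟨equalizer.lift p ?_, equalizer.lift_ι _ _⟩
    rw [comp_compose, comp_compose]
    refine (compose_congr ?_ hp₃ _).trans (hh.comm.trans (compose_congr ?_ ?_ _))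
    · exact (Category.assoc _ _ _).symm.trans (congrArg (· ≫ F.algStr) hp₁)
    · exact (congrArg (· ≫ F.mor) hp₃.symm).trans (Category.assoc _ _ _)
    · exact (congrArg (· ≫ F.algStr) hp₂.symm).trans (Category.assoc _ _ _)
  exact ⟨m, by rw [algDom, reassoc_of% hm, hp₁], by rw [algCod, reassoc_of% hm, hp₂],
    by rw [algApp, reassoc_of% hm, hp₃]⟩

/-- The classifying map of a family of algebra morphisms. -/
noncomputable def algMorLift {T : E} {a b : T ⟶ F.algObj} {h : T ⟶ C.mor}
    (hh : (F.univAlg.reindex a).IsHom (F.univAlg.reindex b) h) : T ⟶ F.algMor :=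
  (exists_algMorLift hh).choose

theorem algMorLift_dom {T : E} {a b : T ⟶ F.algObj} {h : T ⟶ C.mor}
    (hh : (F.univAlg.reindex a).IsHom (F.univAlg.reindex b) h) :
    algMorLift hh ≫ F.algDom = a := (exists_algMorLift hh).choose_spec.1

theorem algMorLift_cod {T : E} {a b : T ⟶ F.algObj} {h : T ⟶ C.mor}
    (hh : (F.univAlg.reindex a).IsHom (F.univAlg.reindex b) h) :
    algMorLift hh ≫ F.algCod = b := (exists_algMorLift hh).choose_spec.2.1

theorem algMorLift_app {T : E} {a b : T ⟶ F.algObj} {h : T ⟶ C.mor}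
    (hh : (F.univAlg.reindex a).IsHom (F.univAlg.reindex b) h) :
    algMorLift hh ≫ F.algApp = h := (exists_algMorLift hh).choose_spec.2.2

/-- The composite of two composable generalized algebra morphisms. -/
noncomputable def algComp {T : E} (m n : T ⟶ F.algMor) (h : m ≫ F.algCod = n ≫ F.algDom) :
    T ⟶ F.algMor :=
  algMorLift ((isHom_comp_algApp m rfl rfl).composite (isHom_comp_algApp n h.symm rfl))

theorem algComp_dom {T : E} (m n : T ⟶ F.algMor) (h : m ≫ F.algCod = n ≫ F.algDom) :
    algComp m n h ≫ F.algDom = m ≫ F.algDom := algMorLift_dom _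

theorem algComp_cod {T : E} (m n : T ⟶ F.algMor) (h : m ≫ F.algCod = n ≫ F.algDom) :
    algComp m n h ≫ F.algCod = n ≫ F.algCod := algMorLift_cod _

theorem algApp_cod_eq_dom {T : E} (m n : T ⟶ F.algMor) (h : m ≫ F.algCod = n ≫ F.algDom) :
    (m ≫ F.algApp) ≫ C.cod = (n ≫ F.algApp) ≫ C.dom :=
  (isHom_comp_algApp m rfl rfl).hom_cod.trans (isHom_comp_algApp n h.symm rfl).hom_dom.symm

theorem algComp_app {T : E} (m n : T ⟶ F.algMor) (h : m ≫ F.algCod = n ≫ F.algDom) :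
    algComp m n h ≫ F.algApp =
      C.compose (m ≫ F.algApp) (n ≫ F.algApp) (algApp_cod_eq_dom m n h) := algMorLift_app _

theorem comp_algComp {S T : E} (t : S ⟶ T) (m n : T ⟶ F.algMor)
    (h : m ≫ F.algCod = n ≫ F.algDom) :
    t ≫ algComp m n h = algComp (t ≫ m) (t ≫ n) (by simp [h]) := by
  apply algMor_hom_ext
  · rw [algComp_dom, Category.assoc, algComp_dom, Category.assoc]
  · rw [algComp_cod, Category.assoc, algComp_cod, Category.assoc]
  · rw [algComp_app, Category.assoc, algComp_app, comp_compose]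
    exact compose_congr (Category.assoc _ _ _).symm (Category.assoc _ _ _).symm _

/-- Composition in `algCategory` is `algComp` at the universal composable pair; this evaluates it at
an arbitrary pair. -/
theorem lift_algComp {T : E} (m n : T ⟶ F.algMor) (h : m ≫ F.algCod = n ≫ F.algDom) :
    pullback.lift m n h ≫ algComp (pullback.fst F.algCod F.algDom)
      (pullback.snd F.algCod F.algDom) pullback.condition = algComp m n h := by
  have e₁ := pullback.lift_fst m n h
  have e₂ := pullback.lift_snd m n h
  rw [comp_algComp]
  generalize_proofs
  simp only [e₁, e₂]

/-- The reindexings along `𝟙 _` are there because `algMorLift` expects both algebras as pullbacks of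
`univAlg`. -/
theorem algId_isHom (F : InternalFunctor C C) : (F.univAlg.reindex (𝟙 _)).IsHom
    (F.univAlg.reindex (𝟙 _)) (F.univAlg.carrier ≫ C.id) := by
  rw [univAlg_reindex_id]
  exact Alg.IsHom.identity _

variable (F)

/-- The internal category of algebras for an internal endofunctor. -/
noncomputable def algCategory : InternalCategory E where
  obj := F.algObj
  mor := F.algMor
  dom := F.algDom
  cod := F.algCod
  id := algMorLift F.algId_isHom
  comp := algComp (pullback.fst F.algCod F.algDom) (pullback.snd F.algCod F.algDom)
    pullback.condition
  id_dom := algMorLift_dom _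
  id_cod := algMorLift_cod _
  comp_dom := algComp_dom _ _ _
  comp_cod := algComp_cod _ _ _
  id_comp := by
    rw [lift_algComp]
    apply algMor_hom_ext
    · rw [algComp_dom, Category.assoc, algMorLift_dom, Category.id_comp, Category.comp_id]
    · rw [algComp_cod]
    · have e : (F.algDom ≫ algMorLift F.algId_isHom) ≫ F.algApp =
          (F.algDom ≫ F.univAlg.carrier) ≫ C.id := by
        rw [Category.assoc, algMorLift_app, Category.assoc]
      rw [algComp_app, compose_congr e rfl, C.id_compose _ _ ?_]
      exact (isHom_comp_algApp (𝟙 _) (Category.id_comp _) rfl).hom_dom.symm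
  comp_id := by
    rw [lift_algComp]
    apply algMor_hom_ext
    · rw [algComp_dom]
    · rw [algComp_cod, Category.assoc, algMorLift_cod, Category.id_comp, Category.comp_id]
    · have e : (F.algCod ≫ algMorLift F.algId_isHom) ≫ F.algApp =
          (F.algCod ≫ F.univAlg.carrier) ≫ C.id := by
        rw [Category.assoc, algMorLift_app, Category.assoc]
      rw [algComp_app, compose_congr rfl e, C.compose_id _ _ ?_]
      exact (isHom_comp_algApp (𝟙 _) rfl (Category.id_comp _)).hom_cod.symm
  assoc := by
    intro T f g h hfg hgh
    simp only [lift_algComp]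
    apply algMor_hom_ext
    · simp only [algComp_dom]
    · simp only [algComp_cod]
    · simp only [algComp_app]
      exact C.compose_assoc _ _ _ _ _

/-- The forgetful functor from the category of algebras. -/
noncomputable def algForget : InternalFunctor F.algCategory C where
  obj := F.univAlg.carrier
  mor := F.algApp
  mor_dom := F.isHom_algApp.hom_dom
  mor_cod := F.isHom_algApp.hom_cod
  map_id := algMorLift_app F.algId_isHom
  map_comp := algComp_app _ _ pullback.condition

end AlgebraCategory

/-! ### The limit of the forgetful functor is an initial algebra. -/

section Initial

variable {E : Type u} [Category.{v} E] [CartesianMonoidalCategory E] [HasFiniteLimits E]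
  {C : InternalCategory E} {F : InternalFunctor C C} {L : 𝟙_ E ⟶ C.obj}

/-- Naturality of a cone over the forgetful functor, at a family of algebra morphisms. -/
theorem IsCone.compose_isHom {π : F.algObj ⟶ C.mor} (hπ : F.algForget.IsCone L π) {T : E}
    {A B : F.Alg T} {h : T ⟶ C.mor} (hh : A.IsHom B h) :
    C.compose (A.name ≫ π) h (by
        have e : π ≫ C.cod = F.univAlg.carrier := hπ.app_cod
        rw [Category.assoc, e, hh.hom_dom]
        exact congrArg Alg.carrier A.univAlg_reindex_name) = B.name ≫ π := by
  have hh' := hh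
  -- With both algebras written as pullbacks of `univAlg`, the morphism is classified by a map to
  -- `algMor`, and the claim is the naturality of the cone pulled back along that map.
  rw [← A.univAlg_reindex_name, ← B.univAlg_reindex_name] at hh'
  have hc : π ≫ C.cod = F.algStr ≫ C.cod := hπ.app_cod
  have w : (F.algDom ≫ π) ≫ C.cod = F.algApp ≫ C.dom := by
    rw [Category.assoc, hc, algApp_dom, Category.assoc]
  have e : algMorLift hh' ≫ C.compose (F.algDom ≫ π) F.algApp w =
    algMorLift hh' ≫ F.algCod ≫ π := congrArg (algMorLift hh' ≫ ·) hπ.naturality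
  rw [comp_compose] at e
  refine (compose_congr ?_ (algMorLift_app hh').symm _).trans (e.trans ?_)
  · rw [← Category.assoc, algMorLift_dom]
  · rw [← Category.assoc, algMorLift_cod]

/-- Applying `F` to a cone over the forgetful functor and composing with the structure maps gives
a cone. -/
theorem IsCone.algCone {π : F.algObj ⟶ C.mor} (hπ : F.algForget.IsCone L π)
    (w : (π ≫ F.mor) ≫ C.cod = F.algStr ≫ C.dom) :
    F.algForget.IsCone (L ≫ F.obj) (C.compose (π ≫ F.mor) F.algStr w) where
  app_dom := by
    have e : π ≫ C.dom = toUnit _ ≫ L := hπ.app_dom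
    refine (compose_dom _ _ _ _).trans (Eq.trans ?_ (Category.assoc _ L F.obj))
    exact (Category.assoc π F.mor C.dom).trans ((congrArg (π ≫ ·) F.mor_dom).trans
      ((Category.assoc π C.dom F.obj).symm.trans (congrArg (· ≫ F.obj) e)))
  app_cod := compose_cod _ _ _ _
  naturality := by
    have hc : π ≫ C.cod = F.algStr ≫ C.cod := hπ.app_cod
    have v : (F.algDom ≫ π) ≫ C.cod = F.algApp ≫ C.dom := by
      rw [Category.assoc, hc, algApp_dom, Category.assoc]
    have e₁ : C.compose (F.algDom ≫ π) F.algApp v = F.algCod ≫ π := hπ.naturality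
    have e₂ := congrArg (· ≫ F.mor) e₁
    simp only [F.compose_mor, Category.assoc] at e₂
    -- The goal is restated with `algDom`, `algCod` and `algApp` in place of the definitionally
    -- equal projections of `algCategory` and `algForget`, so that the rewrites apply.
    suffices h : C.compose (F.algDom ≫ C.compose (π ≫ F.mor) F.algStr w) F.algApp
        (by rw [Category.assoc, compose_cod, algApp_dom, Category.assoc]) =
        F.algCod ≫ C.compose (π ≫ F.mor) F.algStr w from h
    -- For an algebra morphism `h` from `a` to `b`: `(Fπ_a ; a) ; h = Fπ_a ; (Fh ; b) = (Fπ_a ; Fh)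
    -- ; b = Fπ_b ; b`, the last step being `F` applied to the naturality of `π`.
    rw [compose_congr (C.comp_compose F.algDom (π ≫ F.mor) F.algStr w) rfl, C.compose_assoc,
      compose_congr rfl F.algApp_comm, ← C.compose_assoc, compose_congr e₂ rfl, C.comp_compose]
    · simp only [Category.assoc, F.mor_cod, F.mor_dom]
      rw [reassoc_of% hc, reassoc_of% F.algApp_dom]
    · exact F.algApp_dom.symm

/-- An internal endofunctor whose forgetful functor from algebras has a limit has an initial
algebra. -/
theorem IsLimitCone.exists_isInitial {π : F.algObj ⟶ C.mor} (hπ : F.algForget.IsLimitCone L π) :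
    ∃ A : F.Alg (𝟙_ E), A.IsInitial := by
  have hd : π ≫ C.dom = toUnit _ ≫ L := hπ.isCone.app_dom
  have hc : π ≫ C.cod = F.univAlg.carrier := hπ.isCone.app_cod
  have w : (π ≫ F.mor) ≫ C.cod = F.algStr ≫ C.dom := by
    rw [Category.assoc, F.mor_cod, reassoc_of% hc]; exact F.univAlg.str_dom.symm
  -- The domain and codomain of the factorization `c` make it an algebra structure on `L`; the
  -- equation `hcomm`, `c ; π = Fπ ; str`, makes `π` an algebra morphism to the universal algebra.
  obtain ⟨c, hcd, hcc, hcomm⟩ := hπ.exists_lift _ _ (hπ.isCone.algCone w)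
  let A : F.Alg (𝟙_ E) := ⟨L, c, hcd, hcc⟩
  have hu : ∀ {T : E} (t : T ⟶ 𝟙_ E), (A.reindex t).name = t ≫ A.name := fun t => by
    rw [← cancel_mono F.algStr, Alg.name_algStr, Category.assoc, Alg.name_algStr]; rfl
  have hom : (A.reindex (toUnit _)).IsHom F.univAlg π := ⟨hd, hc, hcomm⟩
  have hom' : ∀ {T : E} (B : F.Alg T), (A.reindex (toUnit T)).IsHom B (B.name ≫ π) := fun B => by
    have e := hom.reindex B.name
    rwa [B.univAlg_reindex_name, show (A.reindex (toUnit _)).reindex B.name = A.reindex (toUnit _)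
      from Alg.eq_of_str_eq ((Category.assoc _ _ _).symm.trans
        (congrArg (· ≫ c) (toUnit_unique _ _)))] at e
  have hLc : (A.name ≫ π) ≫ C.cod = L := (hom' A).hom_cod
  -- The component of `π` at `A` itself is the identity, because both endomorphisms of `L` have the
  -- same composite with `π`.
  have hid : A.name ≫ π = L ≫ C.id := by
    refine hπ.lift_unique _ _ ?_ hLc ?_ ?_
    · rw [(hom' A).hom_dom, Category.assoc, C.id_dom, Category.comp_id,
        toUnit_unique (toUnit _) (𝟙 _)]
      exact Category.id_comp _
    · rw [Category.assoc, C.id_cod, Category.comp_id]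
    -- Naturality of the cone is used at its own legs, seen as algebra morphisms out of `A`: `π_A ;
    -- π = π`.
    · have e₁ := hπ.isCone.compose_isHom hom
      have e₂ : F.univAlg.name = 𝟙 _ := by
        rw [← cancel_mono F.algStr, Alg.name_algStr, Category.id_comp]; rfl
      simp only [hu, e₂, Category.id_comp, Category.assoc] at e₁
      refine e₁.trans ((C.id_compose (toUnit _ ≫ L) π hd.symm).symm.trans ?_)
      exact compose_congr (Category.assoc _ _ _) rfl _
  refine ⟨A, fun T B => ⟨B.name ≫ π, hom' B, fun h hh => ?_⟩⟩
  -- Naturality at `h` gives `π_A ; h = π_B` over `T`, and `π_A` is the identity. No factorization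
  -- of `T`-indexed cones is needed.
  have e := hπ.isCone.compose_isHom hh
  rw [← e, compose_congr (by rw [hu, Category.assoc, hid, ← Category.assoc]) rfl]
  exact (C.id_compose (toUnit T ≫ L) h hh.hom_dom.symm).symm

end Initial

end InternalFunctor

theorem mainTheorem1 {E : Type u} [Category.{v} E] [CartesianMonoidalCategory E]
    [HasFiniteLimits E] [MonoidalClosed E] [HasSubobjectClassifier E]
    (C : InternalCategory E) (hC : C.IsComplete) : C.IsAlgebraicallyComplete := by
  intro F
  -- Completeness is applied with the category of `F`-algebras as the indexing category.
  obtain ⟨L, π, h⟩ := hC.exists_isLimitCone F.algForget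
  exact h.exists_isInitial
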